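/- Let $p$ be a prime, $F$ an algebraically closed field of characteristic $p$, and $K=F(u,v)$ with $u,v$ algebraically independent over $F$. Let $K_1=K(x)$ where $u=\dfrac{x^p}{1-x^{p-1}}$. Put $P_0=u$, $P_1=v$, $P_2=v^{p^2}-u$ and $P_{i+1}=P_i^{p^2}-u^{p^{2i-2}}P_{i-1}$ for $i\ge 2$. Let $\nu$ be the real-valued valuation of $K$, trivial on $F$, that is determined by the values $\nu(P_0)=\nu(u)=1$ and $\nu(P_i)=\sum_{j=0}^{i-1}p^{4j-2i}$ for $i\ge 1$, and let $\nu_1$ be the extension of $\nu$ to $K_1$. Let $A_0=F[u,v]_{(u,v)}$ and let $A_{n+1}$ be the quadratic transform of $A_n$ along $\nu$, that is, the localization of $A_n[\mathfrak m/a]$ at the center of $\nu$, where $\mathfrak m$ is the maximal ideal of $A_n$ and $a\in\mathfrak m$ has minimal value. For $k\ge 0$ let $R_k$ be the $k$-th ring (counted from $k=0$, so that $R_0=A_0$) among those $A_n$ in which the divisor of $u$ has a single irreducible component, i.e. in which $u$ is a unit times a positive power of a prime element. Define $P_{0,i}=P_i$ for $i\ge 0$ and, for $k\ge 1$, $u_k=P_{k,0}=P_{k-1,1}$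 and $P_{k,i}=P_{k-1,i+1}/u_k^{p^{2i}}$ for $i\ge 1$. Put $\Omega=\sum_{i\ge 0}p^{-4i}=\dfrac{p^4}{p^4-1}$. Then for every $k\ge 0$: 1) There are $h_k\in R_k$ and $\Theta_k\in K_1$ such that $h_k^p-x^p=(-1)^kP_{k,k+2}+\Theta_k$ and $\nu_1(\Theta_k)>\Omega$; moreover, for this $h_k$, $$\nu_1(h_k^p-x^p)=1+\frac1{p^4}+\cdots+\frac1{p^{4k}}+\frac1{p^{4(k+1)}}.$$ 2) Every $g\in R_k$ satisfies $$\nu_1(g^p-x^p)\le 1+\frac1{p^4}+\cdots+\frac1{p^{4k}}+\frac1{p^{4(k+1)}}.$$ -/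

import Mathlib

noncomputable section

namespace ArtinSchreier

/-- The ring of fractions `S⁻¹B` inside a field `K`, for a subring `B` of `K` and a
multiplicative set `S` contained in `B`. -/
def fractions {K : Type*} [Field K] (B : Subring K) (S : Submonoid K)
    (hS : S ≤ B.toSubmonoid) : Subring K where
  carrier := {z | ∃ a ∈ B, ∃ b ∈ S, z = a / b}
  one_mem' := ⟨1, B.one_mem, 1, S.one_mem, by simp⟩
  zero_mem' := ⟨0, B.zero_mem, 1, S.one_mem, by simp⟩
  mul_mem' := by
    rintro _ _ ⟨a, ha, b, hb, rfl⟩ ⟨c, hc, d, hd, rfl⟩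
    exact ⟨a * c, B.mul_mem ha hc, b * d, S.mul_mem hb hd, by rw [div_mul_div_comm]⟩
  neg_mem' := by
    rintro _ ⟨a, ha, b, hb, rfl⟩
    exact ⟨-a, B.neg_mem ha, b, hb, by rw [neg_div]⟩
  add_mem' := by
    rintro _ _ ⟨a, ha, b, hb, rfl⟩ ⟨c, hc, d, hd, rfl⟩
    by_cases hb0 : b = 0
    · exact ⟨c, hc, d, hd, by simp [hb0]⟩
    by_cases hd0 : d = 0
    · exact ⟨a, ha, b, hb, by simp [hd0]⟩
    exact ⟨a * d + b * c, B.add_mem (B.mul_mem ha (hS hd)) (B.mul_mem (hS hb) hc),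
      b * d, S.mul_mem hb hd, by rw [div_add_div _ _ hb0 hd0]⟩

/-- The local ring `F[u,v]_{(u,v)}` inside `K`: the quotients `f(u,v) / g(u,v)` of polynomials
with `g(0,0) ≠ 0`. -/
def originLocalRing (F : Type*) {K : Type*} [Field F] [Field K] [Algebra F K] (u v : K) :
    Subring K :=
  fractions (MvPolynomial.aeval (R := F) ![u, v]).range.toSubring
    (((nonZeroDivisors F).comap
        (MvPolynomial.constantCoeff (R := F) (σ := Fin 2))).map
      (MvPolynomial.aeval (R := F) ![u, v]))
    (by
      rintro _ ⟨g, _, rfl⟩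
      exact ⟨g, rfl⟩)

/-- The elements of value `0` in a subring `B`: when `ν` is nonnegative on `B` they are the
complement in `B` of the center `{b ∈ B | 0 < ν b}` of `ν` on `B`. -/
def valueZero {K : Type*} [Field K] (ν : AddValuation K (WithTop ℝ)) (B : Subring K) :
    Submonoid K where
  carrier := {b | b ∈ B ∧ ν b = 0}
  one_mem' := ⟨B.one_mem, ν.map_one⟩
  mul_mem' := by
    rintro a b ⟨ha, ha0⟩ ⟨hb, hb0⟩
    exact ⟨B.mul_mem ha hb, by rw [ν.map_mul, ha0, hb0, add_zero]⟩

/-- The blow-up ring `A[m/a]`, where `m = {z ∈ A | 0 < ν z}` is the maximal ideal of a local ring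
`A` dominated by `ν` and `a` is an element of `m` of minimal value. All minimal `a` are used at
once; this does not change the localization at the center of `ν`, since the quotient of two of
them has value `0`. -/
def blowUp {K : Type*} [Field K] (ν : AddValuation K (WithTop ℝ)) (A : Subring K) : Subring K :=
  Subring.closure ((A : Set K) ∪
    {z | ∃ y ∈ A, ∃ a ∈ A, 0 < ν y ∧ 0 < ν a ∧ (∀ w ∈ A, 0 < ν w → ν a ≤ ν w) ∧ z = y / a})

/-- The quadratic transform of `A` along `ν`: the localization of `A[m/a]` at the center
of `ν`. -/
def quadraticTransform {K : Type*} [Field K] (ν : AddValuation K (WithTop ℝ)) (A : Subring K) :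
    Subring K :=
  fractions (blowUp ν A) (valueZero ν (blowUp ν A)) (fun _ h => h.1)

/-- The divisor of `u` in the factorial local ring `A` has a single irreducible component:
`u` is a unit times a positive power of a prime element. -/
def HasSingleComponent {K : Type*} [Field K] (u : K) (A : Subring K) : Prop :=
  ∃ hu : u ∈ A, ∃ t : A, Prime t ∧ ∃ n : ℕ, 0 < n ∧ Associated (⟨u, hu⟩ : A) (t ^ n)

/-- The `n`-th iterated quadratic transform of `F[u,v]_{(u,v)}` along `ν`. -/
def iteratedTransform (F : Type*) {K : Type*} [Field F] [Field K] [Algebra F K] (u v : K)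
    (ν : AddValuation K (WithTop ℝ)) (n : ℕ) : Subring K :=
  (quadraticTransform ν)^[n] (originLocalRing F u v)

/-- The local ring `R_k`: the `k`-th ring, counted from `0`, among those iterated quadratic
transforms of `F[u,v]_{(u,v)}` along `ν` in which the divisor of `u` has a single irreducible
component. -/
def freeTransform (F : Type*) {K : Type*} [Field F] [Field K] [Algebra F K] (u v : K)
    (ν : AddValuation K (WithTop ℝ)) (k : ℕ) : Subring K :=
  iteratedTransform F u v ν
    (Nat.nth (fun n => HasSingleComponent u (iteratedTransform F u v ν n)) k)

/-- The sequence `P₀ = u`, `P₁ = v`, `P₂ = v^{p²} - u` and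
`P_{i+1} = P_i^{p²} - u^{p^{2i-2}} P_{i-1}` for `i ≥ 2`. -/
def seqP {K : Type*} [Field K] (p : ℕ) (u v : K) : ℕ → K
  | 0 => u
  | 1 => v
  | 2 => v ^ (p ^ 2) - u
  | (i + 3) => seqP p u v (i + 2) ^ (p ^ 2) - u ^ (p ^ (2 * i + 2)) * seqP p u v (i + 1)

/-- The elements `P_{k,i}`: `P_{0,i} = P_i`, and for `k ≥ 1`, writing `u_k = P_{k,0}`,
`u_k = P_{k-1,1}` and `P_{k,i} = P_{k-1,i+1} / u_k^{p^{2i}}` for `i ≥ 1`. -/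
def seqPP {K : Type*} [Field K] (p : ℕ) (u v : K) : ℕ → ℕ → K
  | 0, i => seqP p u v i
  | (k + 1), 0 => seqPP p u v k 1
  | (k + 1), (i + 1) => seqPP p u v k (i + 2) / seqPP p u v k 1 ^ (p ^ (2 * (i + 1)))

/-- `ν` is the `F`-valuation of `K = F(u,v)` determined by the sequence `P_i`, normalized by
`ν(u) = 1`: it is trivial on `F` and `ν(P_i) = ∑_{j=0}^{i-1} p^{4j-2i}` for `i ≥ 1`. The `P_i` are
successive key polynomials in `v` over `F(u)`, so there is exactly one such valuation. -/
structure IsDeterminedByP (F : Type*) {K : Type*} [Field F] [Field K] [Algebra F K] (p : ℕ)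
    (u v : K) (ν : AddValuation K (WithTop ℝ)) : Prop where
  trivial_on_constants : ∀ c : F, c ≠ 0 → ν (algebraMap F K c) = 0
  value_u : ν u = 1
  value_P : ∀ i : ℕ, 1 ≤ i → ν (seqP p u v i) =
    ((∑ j ∈ Finset.range i, (p : ℝ) ^ (4 * (j : ℤ) - 2 * (i : ℤ)) : ℝ) : WithTop ℝ)

end ArtinSchreier

end

/-!
The argument rests on the self-similarity of the tower of local rings. Call `(a, b)` a parameter
pair if it generates `K` over `F` and if, up to a scaling factor `c`, the valuation `ν` takes on
`a` and on the sequence `P_i` built from `(a, b)` the prescribed values. With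
`b' = 1 - a / b ^ (p ^ 2)` and `a' = (1 - b') ^ (p ^ 2) * b` the sequence of `(a', b')` is the
shifted sequence `P_{i+1} / b ^ (p ^ (2 i))` (`seqP_next`), so that `(a', b')` is again a parameter
pair, with factor `c / p ^ 2` (`IsParameterPair.next`). Iterating from `(u, v)` gives pairs
`(a_k, b_k)` with `c = p ^ (-2 k)`, and `P_{k,i}` is the sequence of the `k`-th pair for `i ≥ 1`
(`seqPP_eq`).

On the side of the rings, `ν` dominates `F[a,b]_{(a,b)}`, whose quadratic transform is
`F[a/b - c, b]_{(a/b - c, b)}` for the constant `c` that makes the value of `a/b - c` positive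
(`quadraticTransform_originLocalRing`). The first `p ^ 2 - 1` transforms divide `a` by `b`, the
next one reaches the ring of `(a', b')`. In the ring of `(a_k, b_k)` the element `u` is a unit times
a power of `a_k`, while in the rings strictly between two of these it is divisible by two
non-associated primes (`hasSingleComponent_iff`). Hence `R_k = F[a_k, b_k]_{(a_k, b_k)}`
(`freeTransform_eq`).

For the first part, `x ^ p = u - u x ^ (p - 1)`, so `v ^ p` serves as `h_0`. In characteristic `p`
one has `P_{k,k+2} = P_{k+1,k+2} ^ (p ^ 2) - P_{k+1,k+3}` up to a term of value at least `2`
(`seqP_eq_next`), and subtracting `(-1) ^ k P_{k+1,k+2} ^ p` from `h_k` gives `h_{k+1}`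
(`exists_approximation`).

For the second part let `γ_k` be the asserted bound. If `g` violated it, `h_k - g ∈ R_k` would have
value `γ_k / p`, which is less than the value of `P_{k,k+3}`. An element of `R_k` of smaller value
than `P_{k,k+3}` has the value of its remainder modulo this key polynomial. By expansion in the
earlier key polynomials, all of whose terms have different values, that value lies in
`p ^ (-4 (k + 1)) ℤ` (`value_of_lt_keyValue`), and `γ_k / p` does not (`sum_ne_mul`).
-/

noncomputable section

namespace ArtinSchreier

/-! ### Arithmetic of real values -/

section Values

variable {K : Type*} [Field K] {ν : AddValuation K (WithTop ℝ)}

lemma ne_zero_of_value {z : K} {r : ℝ} (h : ν z = (r : WithTop ℝ)) : z ≠ 0 := by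
  rintro rfl
  rw [ν.map_zero] at h
  exact WithTop.top_ne_coe h

lemma eq_zero_or_value_eq_coe (ν : AddValuation K (WithTop ℝ)) (z : K) :
    z = 0 ∨ ∃ r : ℝ, ν z = (r : WithTop ℝ) := by
  by_cases h : z = 0
  · exact Or.inl h
  · right
    have := ν.ne_top_iff.2 h
    exact ⟨(ν z).untop this, by simp⟩

lemma value_mul {z w : K} {r s : ℝ} (hz : ν z = (r : WithTop ℝ)) (hw : ν w = (s : WithTop ℝ)) :
    ν (z * w) = ((r + s : ℝ) : WithTop ℝ) := by
  rw [ν.map_mul, hz, hw, WithTop.coe_add]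

lemma value_pow {z : K} {r : ℝ} (hz : ν z = (r : WithTop ℝ)) (n : ℕ) :
    ν (z ^ n) = ((n * r : ℝ) : WithTop ℝ) := by
  induction n with
  | zero => simp
  | succ n ih => rw [pow_succ, value_mul ih hz]; congr 1; push_cast; ring

lemma value_div {z w : K} {r s : ℝ} (hz : ν z = (r : WithTop ℝ)) (hw : ν w = (s : WithTop ℝ)) :
    ν (z / w) = ((r - s : ℝ) : WithTop ℝ) := by
  rw [ν.map_div, hz, hw]; rfl

lemma value_inv_eq_zero {z : K} (hz : ν z = 0) : ν z⁻¹ = 0 := by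
  have := value_div (ν := ν) (z := 1) (w := z) (r := 0) (s := 0) (by simp) (by simpa using hz)
  simpa using this

end Values

/-! ### The local ring of a pair of parameters -/

section LocalRing

open MvPolynomial

variable {F K : Type*} [Field F] [Field K] [Algebra F K] {a b : K}

lemma mem_originLocalRing {z : K} : z ∈ originLocalRing F a b ↔
    ∃ f g : MvPolynomial (Fin 2) F, constantCoeff g ≠ 0 ∧
      z = aeval ![a, b] f / aeval ![a, b] g := by
  constructor
  · rintro ⟨_, ⟨f, rfl⟩, _, ⟨g, hg, rfl⟩, rfl⟩
    exact ⟨f, g, nonZeroDivisors.ne_zero hg, rfl⟩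
  · rintro ⟨f, g, hg, rfl⟩
    exact ⟨_, ⟨f, rfl⟩, _, ⟨g, mem_nonZeroDivisors_of_ne_zero hg, rfl⟩, rfl⟩

lemma aeval_mem_originLocalRing (f : MvPolynomial (Fin 2) F) :
    aeval ![a, b] f ∈ originLocalRing F a b :=
  mem_originLocalRing.2 ⟨f, 1, by simp, by simp⟩

lemma algebraMap_mem_originLocalRing (c : F) : algebraMap F K c ∈ originLocalRing F a b := by
  simpa using aeval_mem_originLocalRing (a := a) (b := b) (C c)

lemma left_mem_originLocalRing : a ∈ originLocalRing F a b := by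
  simpa using aeval_mem_originLocalRing (F := F) (a := a) (b := b) (X 0)

lemma right_mem_originLocalRing : b ∈ originLocalRing F a b := by
  simpa using aeval_mem_originLocalRing (F := F) (a := a) (b := b) (X 1)

lemma exists_eq_C_add_X_mul (f : MvPolynomial (Fin 2) F) :
    ∃ r s, f = C (constantCoeff f) + (X 0 * r + X 1 * s) := by
  induction f using MvPolynomial.induction_on with
  | C c => exact ⟨0, 0, by simp⟩
  | add f g hf hg =>
    obtain ⟨r, s, h⟩ := hf
    obtain ⟨r', s', h'⟩ := hg
    refine ⟨r + r', s + s', ?_⟩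
    conv_lhs => rw [h, h']
    simp only [map_add]
    ring
  | mul_X f i _ =>
    fin_cases i
    · exact ⟨f, 0, by simp [mul_comm]⟩
    · exact ⟨0, f, by simp [mul_comm]⟩

variable {ν : AddValuation K (WithTop ℝ)}

lemma value_algebraMap_nonneg (hF : ∀ c : F, c ≠ 0 → ν (algebraMap F K c) = 0) (c : F) :
    0 ≤ ν (algebraMap F K c) := by
  by_cases h : c = 0
  · simp [h]
  · rw [hF c h]

section
variable (hF : ∀ c : F, c ≠ 0 → ν (algebraMap F K c) = 0) (ha : 0 < ν a) (hb : 0 < ν b)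
include hF ha hb

lemma value_aeval_nonneg (f : MvPolynomial (Fin 2) F) : 0 ≤ ν (aeval ![a, b] f) := by
  induction f using MvPolynomial.induction_on with
  | C c => simpa using value_algebraMap_nonneg hF c
  | add f g hf hg => rw [map_add]; exact ν.map_le_add hf hg
  | mul_X f i hf =>
    rw [map_mul, ν.map_mul, aeval_X]
    refine add_nonneg hf ?_
    fin_cases i
    · exact ha.le
    · exact hb.le

lemma value_aeval_sub_constantCoeff_pos (f : MvPolynomial (Fin 2) F) :
    0 < ν (aeval ![a, b] f - algebraMap F K (constantCoeff f)) := by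
  obtain ⟨r, s, h⟩ := exists_eq_C_add_X_mul f
  have : aeval ![a, b] f - algebraMap F K (constantCoeff f)
      = a * aeval ![a, b] r + b * aeval ![a, b] s := by
    conv_lhs => rw [h]
    simp
  rw [this]
  refine ν.map_lt_add ?_ ?_ <;> rw [ν.map_mul]
  · exact add_pos_of_pos_of_nonneg ha (value_aeval_nonneg hF ha hb _)
  · exact add_pos_of_pos_of_nonneg hb (value_aeval_nonneg hF ha hb _)

lemma value_aeval_eq_zero_iff (f : MvPolynomial (Fin 2) F) :
    ν (aeval ![a, b] f) = 0 ↔ constantCoeff f ≠ 0 := by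
  have h := value_aeval_sub_constantCoeff_pos hF ha hb f
  constructor
  · intro h0 hc
    rw [hc] at h
    simp [h0] at h
  · intro hc
    rw [← hF _ hc] at h
    rw [ν.map_eq_of_lt_sub h, hF _ hc]

lemma value_div_aeval {f g : MvPolynomial (Fin 2) F} (hg : constantCoeff g ≠ 0) :
    ν (aeval ![a, b] f / aeval ![a, b] g) = ν (aeval ![a, b] f) := by
  rw [div_eq_mul_inv, ν.map_mul,
    value_inv_eq_zero ((value_aeval_eq_zero_iff hF ha hb g).2 hg), add_zero]

lemma value_nonneg_of_mem {z : K} (hz : z ∈ originLocalRing F a b) : 0 ≤ ν z := by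
  obtain ⟨f, g, hg, rfl⟩ := mem_originLocalRing.1 hz
  rw [value_div_aeval hF ha hb hg]
  exact value_aeval_nonneg hF ha hb f

/-- The local ring of the pair is dominated by `ν`: an element of value `0` is a unit. -/
lemma inv_mem_originLocalRing {z : K} (hz : z ∈ originLocalRing F a b) (h0 : ν z = 0) :
    z⁻¹ ∈ originLocalRing F a b := by
  obtain ⟨f, g, hg, rfl⟩ := mem_originLocalRing.1 hz
  rw [value_div_aeval hF ha hb hg, value_aeval_eq_zero_iff hF ha hb] at h0
  exact mem_originLocalRing.2 ⟨g, f, h0, by rw [inv_div]⟩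

/-- The maximal ideal is generated by the two parameters. -/
lemma exists_eq_mul_add_mul {z : K} (hz : z ∈ originLocalRing F a b) (h0 : 0 < ν z) :
    ∃ r ∈ originLocalRing F a b, ∃ s ∈ originLocalRing F a b, z = a * r + b * s := by
  obtain ⟨f, g, hg, rfl⟩ := mem_originLocalRing.1 hz
  rw [value_div_aeval hF ha hb hg] at h0
  have hc : constantCoeff f = 0 := by
    by_contra hc
    rw [(value_aeval_eq_zero_iff hF ha hb f).2 hc] at h0
    exact lt_irrefl _ h0
  obtain ⟨r, s, h⟩ := exists_eq_C_add_X_mul f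
  refine ⟨_, mem_originLocalRing.2 ⟨r, g, hg, rfl⟩, _, mem_originLocalRing.2 ⟨s, g, hg, rfl⟩, ?_⟩
  rw [h, hc]
  simp
  ring

/-- The local ring of the pair is the smallest subring that contains the constants and the
parameters and in which the elements of value `0` are invertible. -/
lemma originLocalRing_le {B : Subring K} (hFB : ∀ c : F, algebraMap F K c ∈ B) (haB : a ∈ B)
    (hbB : b ∈ B) (hinv : ∀ z ∈ B, ν z = 0 → z⁻¹ ∈ B) : originLocalRing F a b ≤ B := by
  have key : ∀ f : MvPolynomial (Fin 2) F, aeval ![a, b] f ∈ B := by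
    intro f
    induction f using MvPolynomial.induction_on with
    | C c => simpa using hFB c
    | add f g hf hg => rw [map_add]; exact B.add_mem hf hg
    | mul_X f i hf =>
      rw [map_mul, aeval_X]
      refine B.mul_mem hf ?_
      fin_cases i
      · exact haB
      · exact hbB
  intro z hz
  obtain ⟨f, g, hg, rfl⟩ := mem_originLocalRing.1 hz
  rw [div_eq_mul_inv]
  exact B.mul_mem (key f) (hinv _ (key g) ((value_aeval_eq_zero_iff hF ha hb g).2 hg))

/-- Two pairs of parameters that lie in each other's local rings have the same local ring. -/
lemma originLocalRing_eq {a' b' : K} (ha' : 0 < ν a') (hb' : 0 < ν b')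
    (h1 : a ∈ originLocalRing F a' b') (h2 : b ∈ originLocalRing F a' b')
    (h3 : a' ∈ originLocalRing F a b) (h4 : b' ∈ originLocalRing F a b) :
    originLocalRing F a b = originLocalRing F a' b' :=
  le_antisymm
    (originLocalRing_le hF ha hb algebraMap_mem_originLocalRing h1 h2
      (fun _ hz h => inv_mem_originLocalRing hF ha' hb' hz h))
    (originLocalRing_le hF ha' hb' algebraMap_mem_originLocalRing h3 h4
      (fun _ hz h => inv_mem_originLocalRing hF ha hb hz h))

end

/-! ### Quadratic transforms in coordinates -/

lemma le_quadraticTransform (ν : AddValuation K (WithTop ℝ)) (A : Subring K) :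
    A ≤ quadraticTransform ν A := fun z hz =>
  ⟨z, Subring.subset_closure (Or.inl hz), 1, (valueZero ν _).one_mem, by simp⟩

/-- If `ν b ≤ ν a`, the quadratic transform of the local ring at `(a, b)` is the local ring at
`(a / b - c, b)`, where `c` is the constant which makes `a / b - c` have positive value. -/
lemma quadraticTransform_originLocalRing (hF : ∀ c : F, c ≠ 0 → ν (algebraMap F K c) = 0)
    {s : ℝ} (hs : 0 < s) (hb : ν b = (s : WithTop ℝ)) (hab : ν b ≤ ν a)
    (c : F) (hc : 0 < ν (a / b - algebraMap F K c)) :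
    quadraticTransform ν (originLocalRing F a b)
      = originLocalRing F (a / b - algebraMap F K c) b := by
  have hb0 : b ≠ 0 := ne_zero_of_value hb
  have hbpos : 0 < ν b := by rw [hb]; exact_mod_cast hs
  have hapos : 0 < ν a := hbpos.trans_le hab
  set A := originLocalRing F a b with hA
  set a' := a / b - algebraMap F K c with ha'
  set A' := originLocalRing F a' b with hA'
  have hbA : b ∈ A := right_mem_originLocalRing
  have haA : a ∈ A := left_mem_originLocalRing
  have hmin : ∀ w ∈ A, 0 < ν w → ν b ≤ ν w := by
    intro w hw h0
    obtain ⟨r, hr, t, ht, rfl⟩ := exists_eq_mul_add_mul hF hapos hbpos hw h0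
    refine ν.map_le_add ?_ ?_ <;> rw [ν.map_mul]
    · exact hab.trans (le_add_of_nonneg_right (value_nonneg_of_mem hF hapos hbpos hr))
    · exact le_add_of_nonneg_right (value_nonneg_of_mem hF hapos hbpos ht)
  have hquot : a / b ∈ A' := by
    have : a / b = a' + algebraMap F K c := by rw [ha']; ring
    rw [this]
    exact A'.add_mem left_mem_originLocalRing (algebraMap_mem_originLocalRing c)
  have hbA' : b ∈ A' := right_mem_originLocalRing
  have haA' : a ∈ A' := by
    have : a = a / b * b := by field_simp
    rw [this]
    exact A'.mul_mem hquot hbA'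
  have hinv' : ∀ z ∈ A', ν z = 0 → z⁻¹ ∈ A' := fun z hz h =>
    inv_mem_originLocalRing hF hc hbpos hz h
  have hAA' : A ≤ A' :=
    originLocalRing_le hF hapos hbpos algebraMap_mem_originLocalRing haA' hbA' hinv'
  have hdivb : ∀ y ∈ A, 0 < ν y → y / b ∈ A' := by
    intro y hy h0
    obtain ⟨r, hr, t, ht, rfl⟩ := exists_eq_mul_add_mul hF hapos hbpos hy h0
    have : (a * r + b * t) / b = a / b * r + t := by field_simp
    rw [this]
    exact A'.add_mem (A'.mul_mem hquot (hAA' hr)) (hAA' ht)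
  have hblow : blowUp ν A ≤ A' := by
    refine Subring.closure_le.2 (Set.union_subset hAA' ?_)
    rintro _ ⟨y, hy, w, hw, hy0, hw0, hwmin, rfl⟩
    have hwb : ν w = ν b := le_antisymm (hwmin b hbA hbpos) (hmin w hw hw0)
    have hw' : ν (w / b) = 0 := by
      rw [value_div (hwb.trans hb) hb]; simp
    have : y / w = y / b * (w / b)⁻¹ := by
      rw [inv_div]; field_simp
    rw [this]
    exact A'.mul_mem (hdivb y hy hy0) (hinv' _ (hdivb w hw hw0) hw')
  apply le_antisymm
  · rintro _ ⟨z, hz, w, ⟨hw, hw0⟩, rfl⟩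
    rw [div_eq_mul_inv]
    exact A'.mul_mem (hblow hz) (hinv' w (hblow hw) hw0)
  · have hle := le_quadraticTransform ν A
    have hcQ : ∀ d : F, algebraMap F K d ∈ quadraticTransform ν A := fun d =>
      hle (algebraMap_mem_originLocalRing d)
    refine originLocalRing_le hF hc hbpos hcQ ?_ (hle hbA) ?_
    · refine Subring.sub_mem _ ?_ (hcQ c)
      exact ⟨a / b, Subring.subset_closure (Or.inr ⟨a, haA, b, hbA, hapos, hbpos, hmin, rfl⟩),
        1, (valueZero ν _).one_mem, by simp⟩
    · rintro _ ⟨z, hz, w, ⟨hw, hw0⟩, rfl⟩ h0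
      refine ⟨w, hw, z, ⟨hz, ?_⟩, by rw [inv_div]⟩
      rwa [div_eq_mul_inv, ν.map_mul, value_inv_eq_zero hw0, add_zero] at h0

end LocalRing

/-! ### Divisibility in the local ring of independent parameters -/

section Divisibility

open MvPolynomial

variable {F K : Type*} [Field F] [Field K] [Algebra F K] {a b : K}

/-- Two generators of a field of transcendence degree `2` are algebraically independent. -/
lemma algebraicIndependent_of_adjoin_eq_top {u v : K} (huv : AlgebraicIndependent F ![u, v])
    (h : IntermediateField.adjoin F {a, b} = ⊤) : AlgebraicIndependent F ![a, b] := by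
  have : Algebra.IsAlgebraic (Algebra.adjoin F (Set.range ![a, b])) K := by
    refine ⟨fun z => ?_⟩
    have hz : z ∈ IntermediateField.adjoin F {a, b} := by rw [h]; trivial
    obtain ⟨r, hr, s, hs, rfl⟩ := IntermediateField.mem_adjoin_iff_div.1 hz
    have hrange : Set.range ![a, b] = {a, b} := by simp [Set.pair_comm]
    rw [← hrange] at hr hs
    rw [div_eq_mul_inv]
    exact (isAlgebraic_algebraMap (⟨r, hr⟩ : Algebra.adjoin F (Set.range ![a, b]))).mul
      (isAlgebraic_algebraMap (⟨s, hs⟩ : Algebra.adjoin F (Set.range ![a, b]))).inv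
  have hle := huv.lift_cardinalMk_le_trdeg
  exact (Algebra.IsAlgebraic.isTranscendenceBasis_of_lift_le_trdeg_of_finite F ![a, b] hle).1

lemma X_not_dvd_of_constantCoeff_ne_zero {i : Fin 2} {g : MvPolynomial (Fin 2) F}
    (hg : constantCoeff g ≠ 0) : ¬ X i ∣ g := by
  rintro ⟨r, rfl⟩
  simp at hg

section
variable (hab : AlgebraicIndependent F ![a, b])
include hab

lemma aeval_ne_zero {g : MvPolynomial (Fin 2) F} (hg : g ≠ 0) : aeval ![a, b] g ≠ 0 :=
  (map_ne_zero_iff _ hab).2 hg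

/-- Divisibility by the parameter `![a, b] i` in the local ring is divisibility of the numerator
by the corresponding variable. -/
lemma param_dvd_iff {i : Fin 2} {f g : MvPolynomial (Fin 2) F} (hg : constantCoeff g ≠ 0) :
    (∃ w ∈ originLocalRing F a b,
      aeval ![a, b] f / aeval ![a, b] g = (![a, b] i) * w) ↔ X i ∣ f := by
  have hne : ∀ {g : MvPolynomial (Fin 2) F}, constantCoeff g ≠ 0 → aeval ![a, b] g ≠ 0 :=
    fun h => aeval_ne_zero hab (by rintro rfl; simp at h)
  constructor
  · rintro ⟨_, hw, h⟩
    obtain ⟨f', g', hg', rfl⟩ := mem_originLocalRing.1 hw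
    have h1 : aeval ![a, b] (f * g') = aeval ![a, b] (X i * (f' * g)) := by
      have h2 := hne hg
      have h3 := hne hg'
      simp only [map_mul, aeval_X]
      field_simp at h
      rw [h]; ring
    have h2 : X i ∣ f * g' := ⟨_, hab h1⟩
    exact ((X_prime (i := i)).dvd_or_dvd h2).resolve_right
      (X_not_dvd_of_constantCoeff_ne_zero hg')
  · rintro ⟨r, rfl⟩
    refine ⟨_, mem_originLocalRing.2 ⟨r, g, hg, rfl⟩, ?_⟩
    rw [map_mul, aeval_X, mul_div_assoc]

/-- Each of the two parameters is a prime element of the local ring. -/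
lemma prime_param (i : Fin 2) (hi : ![a, b] i ∈ originLocalRing F a b) :
    Prime (⟨![a, b] i, hi⟩ : originLocalRing F a b) := by
  have key : ∀ {f g : MvPolynomial (Fin 2) F} (hg : constantCoeff g ≠ 0)
      (hm : aeval ![a, b] f / aeval ![a, b] g ∈ originLocalRing F a b),
      ((⟨![a, b] i, hi⟩ : originLocalRing F a b) ∣ ⟨_, hm⟩ ↔ X i ∣ f) := by
    intro f g hg hm
    rw [← param_dvd_iff hab hg]
    constructor
    · rintro ⟨w, hw⟩
      exact ⟨w, w.2, congrArg Subtype.val hw⟩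
    · rintro ⟨w, hwA, hw⟩
      exact ⟨⟨w, hwA⟩, Subtype.ext hw⟩
  refine ⟨?_, ?_, ?_⟩
  · intro h
    have h' : ![a, b] i = 0 := congrArg Subtype.val h
    have := aeval_ne_zero hab (X_ne_zero (R := F) i)
    rw [aeval_X] at this
    exact this h'
  · intro h
    have h1 : (⟨![a, b] i, hi⟩ : originLocalRing F a b)
        ∣ ⟨aeval ![a, b] (1 : MvPolynomial (Fin 2) F) / aeval ![a, b] (1 : MvPolynomial (Fin 2) F),
          mem_originLocalRing.2 ⟨1, 1, by simp, rfl⟩⟩ := h.dvd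
    rw [key (by simp)] at h1
    exact X_not_dvd_of_constantCoeff_ne_zero (by simp) h1
  · rintro ⟨z, hz⟩ ⟨w, hw⟩ h
    obtain ⟨f, g, hg, rfl⟩ := mem_originLocalRing.1 hz
    obtain ⟨f', g', hg', rfl⟩ := mem_originLocalRing.1 hw
    have hm : aeval ![a, b] (f * f') / aeval ![a, b] (g * g') ∈ originLocalRing F a b :=
      mem_originLocalRing.2 ⟨_, _, by simp [hg, hg'], rfl⟩
    have h1 : (⟨![a, b] i, hi⟩ : originLocalRing F a b) ∣ ⟨_, hm⟩ := by
      convert h using 1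
      exact Subtype.ext (by
        simp only [map_mul, MulMemClass.mk_mul_mk]
        rw [div_mul_div_comm])
    rw [key (by simp [hg, hg'])] at h1
    rw [key hg, key hg']
    exact (X_prime (i := i)).dvd_or_dvd h1

lemma left_not_dvd_right : ¬ ∃ w ∈ originLocalRing F a b, b = a * w := by
  rintro ⟨w, hw, h⟩
  have h1 := (param_dvd_iff hab (i := 0) (f := X 1) (g := 1) (by simp)).1
    ⟨w, hw, by simpa using h⟩
  obtain ⟨r, hr⟩ := h1
  have := congrArg (eval ![(0 : F), 1]) hr
  simp at this

/-- A unit times a positive power of a parameter has a single irreducible component. -/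
lemma hasSingleComponent_of_eq {u w : K} {n : ℕ} (hn : 0 < n) (hu : u = w * a ^ n)
    (hw : w ∈ originLocalRing F a b) (hw' : w⁻¹ ∈ originLocalRing F a b) (hw0 : w ≠ 0) :
    HasSingleComponent u (originLocalRing F a b) := by
  have haA : a ∈ originLocalRing F a b := left_mem_originLocalRing
  refine ⟨hu ▸ Subring.mul_mem _ hw (Subring.pow_mem _ haA n), ⟨a, haA⟩,
    prime_param hab 0 haA, n, hn, ?_⟩
  refine ⟨⟨⟨w⁻¹, hw'⟩, ⟨w, hw⟩, Subtype.ext (by simp [hw0]), Subtype.ext (by simp [hw0])⟩, ?_⟩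
  refine Subtype.ext ?_
  simp only [hu, Subring.coe_mul, SubmonoidClass.mk_pow]
  field_simp

/-- An element divisible by both parameters does not have a single irreducible component. -/
lemma not_hasSingleComponent_of_eq {u z w : K} (hz : z ∈ originLocalRing F a b)
    (hw : w ∈ originLocalRing F a b) (hu : u = a * z) (hu' : u = b * w) :
    ¬ HasSingleComponent u (originLocalRing F a b) := by
  rintro ⟨huA, t, ht, n, -, hun⟩
  have haA : a ∈ originLocalRing F a b := left_mem_originLocalRing
  have hbA : b ∈ originLocalRing F a b := right_mem_originLocalRing
  have hap : Prime (⟨a, haA⟩ : originLocalRing F a b) := prime_param hab 0 haA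
  have hbp : Prime (⟨b, hbA⟩ : originLocalRing F a b) := prime_param hab 1 hbA
  have h1 : (⟨a, haA⟩ : originLocalRing F a b) ∣ t ^ n :=
    (Dvd.intro ⟨z, hz⟩ (Subtype.ext hu.symm)).trans hun.dvd
  have h2 : (⟨b, hbA⟩ : originLocalRing F a b) ∣ t ^ n :=
    (Dvd.intro ⟨w, hw⟩ (Subtype.ext hu'.symm)).trans hun.dvd
  have h3 := hap.associated_of_dvd ht (hap.dvd_of_dvd_pow h1)
  have h4 := hbp.associated_of_dvd ht (hbp.dvd_of_dvd_pow h2)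
  obtain ⟨q, hq⟩ := (h3.trans h4.symm).dvd
  exact left_not_dvd_right hab ⟨q, q.2, congrArg Subtype.val hq⟩

end

end Divisibility

/-! ### Key polynomials and the values of elements -/

section KeyPolynomials

open Polynomial

/-- The number `∑_{j < i} p^{4j - 2i}`, written with a common denominator. -/
def keyValue (p i : ℕ) : ℝ := (∑ j ∈ Finset.range i, (p : ℝ) ^ (4 * j)) / (p : ℝ) ^ (2 * i)

lemma sum_zpow_eq_keyValue {p : ℕ} (hp : p ≠ 0) (i : ℕ) :
    ∑ j ∈ Finset.range i, (p : ℝ) ^ (4 * (j : ℤ) - 2 * (i : ℤ)) = keyValue p i := by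
  have hp0 : (p : ℝ) ≠ 0 := by exact_mod_cast hp
  rw [keyValue, Finset.sum_div]
  refine Finset.sum_congr rfl fun j _ => ?_
  rw [zpow_sub₀ hp0]
  norm_cast

/-- The key polynomial of index `i`, as a polynomial in `v` over `F[u]`; its value at `(a, b)` is
`seqP p a b i`. -/
def keyPoly (F : Type*) [Field F] (p : ℕ) : ℕ → F[X][X]
  | 0 => C X
  | 1 => X
  | 2 => X ^ (p ^ 2) - C X
  | (i + 3) => keyPoly F p (i + 2) ^ (p ^ 2) - C (X ^ (p ^ (2 * i + 2))) * keyPoly F p (i + 1)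

/-- Evaluation of a polynomial in `v` over `F[u]` at `u = a` and `v = b`. -/
def evalPair {F K : Type*} [Field F] [Field K] [Algebra F K] (a b : K) : F[X][X] →+* K :=
  eval₂RingHom (aeval (R := F) a).toRingHom b

variable {F K : Type*} [Field F] [Field K] [Algebra F K] {a b : K} {p : ℕ}

@[simp] lemma evalPair_X : evalPair (F := F) a b X = b := by simp [evalPair]

@[simp] lemma evalPair_C (r : F[X]) : evalPair (F := F) a b (C r) = aeval a r := by
  simp [evalPair]

lemma evalPair_keyPoly : ∀ i, evalPair (F := F) a b (keyPoly F p i) = seqP p a b i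
  | 0 => by simp [keyPoly, seqP]
  | 1 => by simp [keyPoly, seqP]
  | 2 => by simp [keyPoly, seqP]
  | (i + 3) => by
    have h1 := evalPair_keyPoly (i + 2)
    have h2 := evalPair_keyPoly (i + 1)
    simp [keyPoly, seqP, h1, h2]

lemma keyPoly_monic_natDegree (hp : 1 < p) : ∀ i,
    (keyPoly F p (i + 1)).Monic ∧ (keyPoly F p (i + 1)).natDegree = p ^ (2 * i)
  | 0 => by simp [keyPoly, monic_X]
  | 1 => ⟨monic_X_pow_sub_C _ (by positivity), by
      change natDegree (X ^ (p ^ 2) - C X : F[X][X]) = _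
      rw [natDegree_X_pow_sub_C]⟩
  | (i + 2) => by
    obtain ⟨hm, hd⟩ := keyPoly_monic_natDegree hp (i + 1)
    obtain ⟨hm', hd'⟩ := keyPoly_monic_natDegree hp i
    have hpow : (keyPoly F p (i + 2) ^ (p ^ 2)).natDegree = p ^ (2 * (i + 2)) := by
      rw [hm.natDegree_pow, hd]; ring
    have hlt : (C (X ^ (p ^ (2 * i + 2))) * keyPoly F p (i + 1)).natDegree
        < (keyPoly F p (i + 2) ^ (p ^ 2)).natDegree := by
      rw [hpow]
      refine (natDegree_C_mul_le _ _).trans_lt ?_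
      rw [hd']
      exact Nat.pow_lt_pow_right hp (by omega)
    refine ⟨(hm.pow _).sub_of_left (degree_lt_degree hlt), ?_⟩
    change (keyPoly F p (i + 2) ^ (p ^ 2)
      - C (X ^ (p ^ (2 * i + 2))) * keyPoly F p (i + 1)).natDegree = _
    rw [natDegree_sub_eq_left_of_natDegree_lt hlt, hpow]

lemma exists_evalPair_eq_aeval (f : MvPolynomial (Fin 2) F) :
    ∃ r, MvPolynomial.aeval ![a, b] f = evalPair (F := F) a b r := by
  induction f using MvPolynomial.induction_on with
  | C c => exact ⟨C (C c), by simp⟩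
  | add f g hf hg =>
    obtain ⟨r, hr⟩ := hf
    obtain ⟨s, hs⟩ := hg
    exact ⟨r + s, by rw [map_add, map_add, hr, hs]⟩
  | mul_X f i hf =>
    obtain ⟨r, hr⟩ := hf
    fin_cases i
    · exact ⟨r * C X, by simp [hr]⟩
    · exact ⟨r * X, by simp [hr]⟩

lemma evalPair_mem_originLocalRing (r : F[X][X]) : evalPair a b r ∈ originLocalRing F a b := by
  have hC : ∀ s : F[X], aeval a s ∈ originLocalRing F a b := by
    intro s
    induction s using Polynomial.induction_on' with
    | add f g hf hg => rw [map_add]; exact Subring.add_mem _ hf hg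
    | monomial n c =>
      rw [aeval_monomial]
      exact Subring.mul_mem _ (algebraMap_mem_originLocalRing c)
        (Subring.pow_mem _ left_mem_originLocalRing n)
  induction r using Polynomial.induction_on' with
  | add f g hf hg => rw [map_add]; exact Subring.add_mem _ hf hg
  | monomial n s =>
    rw [← C_mul_X_pow_eq_monomial, map_mul, map_pow, evalPair_X, evalPair_C]
    exact Subring.mul_mem _ (hC s) (Subring.pow_mem _ right_mem_originLocalRing n)

variable {ν : AddValuation K (WithTop ℝ)} {c : ℝ}

/-- The value of a polynomial in `u` alone is a multiple of the value of `u`. -/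
lemma value_aeval_single (hF : ∀ c : F, c ≠ 0 → ν (algebraMap F K c) = 0) (hc : 0 < c)
    (ha : ν a = (c : WithTop ℝ)) (r : F[X]) :
    aeval a r = 0 ∨ ∃ n : ℕ, ν (aeval a r) = ((c * n : ℝ) : WithTop ℝ) := by
  obtain ⟨n, hn⟩ : ∃ n, r.natDegree ≤ n := ⟨_, le_rfl⟩
  induction n generalizing r with
  | zero =>
    rw [eq_C_of_natDegree_le_zero hn, aeval_C]
    by_cases h0 : r.coeff 0 = 0
    · left; simp [h0]
    · right; exact ⟨0, by simp [hF _ h0]⟩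
  | succ n ih =>
    have hr : aeval a r = a * aeval a r.divX + algebraMap F K (r.coeff 0) := by
      have h := congrArg (aeval a) (X_mul_divX_add r)
      rw [map_add, map_mul, aeval_X, aeval_C] at h
      exact h.symm
    have hX := ih r.divX (by rw [natDegree_divX_eq_natDegree_tsub_one]; omega)
    by_cases h0 : r.coeff 0 = 0
    · rw [hr, h0, map_zero, add_zero]
      rcases hX with h | ⟨k, hk⟩
      · left; simp [h]
      · right
        refine ⟨k + 1, ?_⟩
        rw [value_mul ha hk]
        congr 1
        push_cast
        ring
    · right
      refine ⟨0, ?_⟩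
      rw [hr]
      rcases hX with h | ⟨k, hk⟩
      · simp [h, hF _ h0]
      · rw [ν.map_add_eq_of_lt_right, hF _ h0]
        · simp
        · rw [hF _ h0, value_mul ha hk]
          have : 0 < c + c * k := by positivity
          exact_mod_cast this

/-- Multiples of the value of a key polynomial by different exponents below `p²` differ modulo
the values of the polynomials of smaller degree. -/
lemma keyValue_coset_ne (hp : 1 < p) (hc : 0 < c) (m e : ℕ) (he0 : 0 < e) (he : e < p ^ 2)
    (z z' : ℤ) : c * z / (p : ℝ) ^ (2 * m) ≠
      c * z' / (p : ℝ) ^ (2 * m) + e * (c * keyValue p (m + 1)) := by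
  intro h
  have hp0 : (p : ℝ) ≠ 0 := by positivity
  rw [keyValue, Finset.sum_range_succ'] at h
  have hpow : (p : ℝ) ^ (2 * (m + 1)) = p ^ (2 * m) * p ^ 2 := by ring
  rw [hpow] at h
  have h1 : (z : ℝ) * p ^ 2
      = z' * p ^ 2 + e * (p ^ 4 * (∑ j ∈ Finset.range m, (p : ℝ) ^ (4 * j)) + 1) := by
    have h2 : ∑ j ∈ Finset.range m, (p : ℝ) ^ (4 * (j + 1))
        = p ^ 4 * ∑ j ∈ Finset.range m, (p : ℝ) ^ (4 * j) := by
      rw [Finset.mul_sum]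
      exact Finset.sum_congr rfl fun j _ => by ring
    rw [h2] at h
    field_simp at h
    simpa using h
  have h2 : z * (p : ℤ) ^ 2
      = z' * p ^ 2 + e * (p ^ 4 * (∑ j ∈ Finset.range m, (p : ℤ) ^ (4 * j)) + 1) := by
    exact_mod_cast h1
  have h3 : (p : ℤ) ^ 2 ∣ e :=
    ⟨z - z' - e * (p ^ 2 * ∑ j ∈ Finset.range m, (p : ℤ) ^ (4 * j)), by linear_combination -h2⟩
  have h4 : p ^ 2 ∣ e := by exact_mod_cast h3
  exact absurd (Nat.le_of_dvd he0 h4) (not_le.2 he)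

/-- The value of a polynomial whose degree in `v` is less than that of the key polynomial
`P_{m+1}` lies in `c p^{-2m} ℤ`. -/
lemma value_evalPair_of_natDegree_lt (hp : 1 < p)
    (hF : ∀ c : F, c ≠ 0 → ν (algebraMap F K c) = 0) (hc : 0 < c)
    (ha : ν a = (c : WithTop ℝ))
    (hP : ∀ i, 1 ≤ i → ν (seqP p a b i) = ((c * keyValue p i : ℝ) : WithTop ℝ))
    (m : ℕ) (r : F[X][X]) (hr : r.natDegree < p ^ (2 * m)) :
    evalPair a b r = 0 ∨
      ∃ z : ℤ, ν (evalPair a b r) = ((c * z / (p : ℝ) ^ (2 * m) : ℝ) : WithTop ℝ) := by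
  induction m generalizing r with
  | zero =>
    rw [eq_C_of_natDegree_eq_zero (p := r) (by simpa using hr), evalPair_C]
    rcases value_aeval_single hF hc ha (r.coeff 0) with h | ⟨n, hn⟩
    · exact Or.inl h
    · exact Or.inr ⟨n, by simp [hn]⟩
  | succ m ih =>
    have hp0 : (p : ℝ) ≠ 0 := by positivity
    obtain ⟨hQm, hQd⟩ := keyPoly_monic_natDegree (F := F) hp m
    set Q := keyPoly F p (m + 1) with hQ
    have hQv : ν (evalPair a b Q) = ((c * keyValue p (m + 1) : ℝ) : WithTop ℝ) := by
      rw [hQ, evalPair_keyPoly, hP _ (by omega)]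
    have hQ1 : Q ≠ 1 := by
      intro h
      rw [h, natDegree_one] at hQd
      exact (pow_pos (by omega : 0 < p) (2 * m)).ne hQd
    -- Expansion in powers of `Q` with coefficients of smaller degree, by the number of terms.
    have key : ∀ n, 1 ≤ n → n ≤ p ^ 2 → ∀ r : F[X][X], r.natDegree < n * p ^ (2 * m) →
        evalPair a b r = 0 ∨ ∃ e : ℕ, e < n ∧ ∃ z : ℤ, ν (evalPair a b r)
          = ((c * z / (p : ℝ) ^ (2 * m) + e * (c * keyValue p (m + 1)) : ℝ) : WithTop ℝ) := by
      intro n hn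
      induction n, hn using Nat.le_induction with
      | base =>
        intro _ r hr
        rcases ih r (by simpa using hr) with h | ⟨z, hz⟩
        · exact Or.inl h
        · exact Or.inr ⟨0, one_pos, z, by simp [hz]⟩
      | succ n hn ihn =>
        intro hnp r hr
        have hsplit : evalPair a b r
            = evalPair a b (r %ₘ Q) + evalPair a b Q * evalPair a b (r /ₘ Q) := by
          rw [← map_mul, ← map_add, modByMonic_add_div r Q]
        have hmod := ih (r %ₘ Q) (hQd ▸ natDegree_modByMonic_lt r hQm hQ1)
        have hdiv := ihn (by omega) (r /ₘ Q) (by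
          rw [natDegree_divByMonic r hQm, hQd]
          have : 0 < n * p ^ (2 * m) := by positivity
          rw [Nat.succ_mul] at hr
          omega)
        rw [hsplit]
        rcases hdiv with hd | ⟨e, he, z', hz'⟩
        · rcases hmod with h | ⟨z, hz⟩
          · left; simp [h, hd]
          · right; exact ⟨0, by omega, z, by simp [hd, hz]⟩
        · have hprod : ν (evalPair a b Q * evalPair a b (r /ₘ Q))
              = ((c * z' / (p : ℝ) ^ (2 * m) + (e + 1 : ℕ) * (c * keyValue p (m + 1)) : ℝ) :
                WithTop ℝ) := by
            rw [value_mul hQv hz']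
            congr 1
            push_cast
            ring
          right
          rcases hmod with h | ⟨z, hz⟩
          · exact ⟨e + 1, by omega, z', by rw [h, zero_add, hprod]⟩
          · have hne : ν (evalPair a b (r %ₘ Q))
                ≠ ν (evalPair a b Q * evalPair a b (r /ₘ Q)) := by
              rw [hz, hprod]
              exact fun h => keyValue_coset_ne hp hc m (e + 1) (by omega) (by omega) z z'
                (WithTop.coe_injective h)
            rw [ν.map_add_of_distinct_val hne]
            rcases min_choice (ν (evalPair a b (r %ₘ Q)))
              (ν (evalPair a b Q * evalPair a b (r /ₘ Q))) with h | h
            · exact ⟨0, by omega, z, by rw [h, hz]; simp⟩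
            · exact ⟨e + 1, by omega, z', by rw [h, hprod]⟩
    have hr' : r.natDegree < p ^ 2 * p ^ (2 * m) := by
      rwa [← pow_add, show 2 + 2 * m = 2 * (m + 1) by ring]
    rcases key (p ^ 2) (Nat.one_le_pow _ _ (by omega)) le_rfl r hr' with h | ⟨e, -, z, hz⟩
    · exact Or.inl h
    · refine Or.inr ⟨z * p ^ 2 + e * ∑ j ∈ Finset.range (m + 1), (p : ℤ) ^ (4 * j), ?_⟩
      rw [hz, keyValue]
      congr 1
      push_cast
      rw [show 2 * (m + 1) = 2 * m + 2 by ring, pow_add]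
      field_simp

/-- An element of the local ring of value less than that of `P_{m+1}` has its value in
`c p^{-2m} ℤ`, because it may be replaced by its remainder modulo `P_{m+1}`. -/
lemma value_of_lt_keyValue (hp : 1 < p)
    (hF : ∀ c : F, c ≠ 0 → ν (algebraMap F K c) = 0) (hc : 0 < c)
    (ha : ν a = (c : WithTop ℝ)) (hb : 0 < ν b)
    (hP : ∀ i, 1 ≤ i → ν (seqP p a b i) = ((c * keyValue p i : ℝ) : WithTop ℝ))
    (m : ℕ) {f : K} (hf : f ∈ originLocalRing F a b)
    (hlt : ν f < ((c * keyValue p (m + 1) : ℝ) : WithTop ℝ)) :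
    ∃ z : ℤ, ν f = ((c * z / (p : ℝ) ^ (2 * m) : ℝ) : WithTop ℝ) := by
  have hapos : 0 < ν a := by rw [ha]; exact_mod_cast hc
  obtain ⟨g, h, hh, rfl⟩ := mem_originLocalRing.1 hf
  rw [value_div_aeval hF hapos hb hh] at hlt ⊢
  obtain ⟨r, hr⟩ := exists_evalPair_eq_aeval (a := a) (b := b) g
  rw [hr] at hlt ⊢
  obtain ⟨hQm, hQd⟩ := keyPoly_monic_natDegree (F := F) hp m
  set Q := keyPoly F p (m + 1) with hQ
  have hQ1 : Q ≠ 1 := by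
    intro h
    rw [h, natDegree_one] at hQd
    exact (pow_pos (by omega : 0 < p) (2 * m)).ne hQd
  have hsplit : evalPair a b (r %ₘ Q)
      = evalPair a b r - evalPair a b Q * evalPair a b (r /ₘ Q) := by
    rw [← map_mul, ← map_sub, eq_sub_of_add_eq (modByMonic_add_div r Q)]
  have hbig : ν (evalPair a b r) < ν (evalPair a b Q * evalPair a b (r /ₘ Q)) := by
    rw [ν.map_mul, hQ, evalPair_keyPoly, hP _ (by omega)]
    exact hlt.trans_le (le_add_of_nonneg_right
      (value_nonneg_of_mem hF hapos hb (evalPair_mem_originLocalRing _)))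
  have hv : ν (evalPair a b (r %ₘ Q)) = ν (evalPair a b r) := by
    rw [hsplit, ν.map_sub_eq_of_lt_left hbig]
  rcases value_evalPair_of_natDegree_lt hp hF hc ha hP m (r %ₘ Q)
    (hQd ▸ natDegree_modByMonic_lt r hQm hQ1) with h0 | ⟨z, hz⟩
  · rw [h0, ν.map_zero] at hv
    rw [← hv] at hlt
    exact absurd hlt (not_lt.2 le_top)
  · exact ⟨z, by rw [← hv, hz]⟩

end KeyPolynomials

/-! ### The sequence of parameters -/

section Parameters

variable {F K : Type*} [Field F] [Field K] [Algebra F K] {a b : K} {p : ℕ}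
  {ν : AddValuation K (WithTop ℝ)} {c : ℝ}

/-- A pair of generators `a, b` of `K` over `F` at which `ν` takes, up to the scaling factor `c`,
the values prescribed for `u`, `v` and the sequence `P_i`. -/
structure IsParameterPair (F : Type*) {K : Type*} [Field F] [Field K] [Algebra F K] (p : ℕ)
    (ν : AddValuation K (WithTop ℝ)) (c : ℝ) (a b : K) : Prop where
  adjoin_eq_top : IntermediateField.adjoin F {a, b} = ⊤
  trivial_on_constants : ∀ c : F, c ≠ 0 → ν (algebraMap F K c) = 0
  pos : 0 < c
  value_left : ν a = (c : WithTop ℝ)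
  value_seqP : ∀ i, 1 ≤ i → ν (seqP p a b i) = ((c * keyValue p i : ℝ) : WithTop ℝ)

/-- The first coordinate of the parameters reached after `p²` quadratic transforms. It differs
from `b` by the unit `(a / b ^ p²) ^ p²`, chosen so that the key polynomials of the new pair are
obtained from those of the old one by shifting the index. -/
def nextLeft (p : ℕ) (a b : K) : K := (a / b ^ (p ^ 2)) ^ (p ^ 2) * b

/-- The second coordinate of the parameters reached after `p²` quadratic transforms. -/
def nextRight (p : ℕ) (a b : K) : K := 1 - a / b ^ (p ^ 2)

lemma seqP_next (hb : b ≠ 0) : ∀ i,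
    seqP p (nextLeft p a b) (nextRight p a b) (i + 1)
      = seqP p a b (i + 2) / b ^ (p ^ (2 * (i + 1)))
  | 0 => by
    simp only [seqP, nextRight]
    field_simp
  | 1 => by
    simp only [seqP, nextLeft, nextRight]
    have h1 : 1 - a / b ^ (p ^ 2) = (b ^ (p ^ 2) - a) / b ^ (p ^ 2) := by field_simp
    rw [h1, div_pow, div_pow, ← pow_mul]
    simp only [mul_zero, zero_add]
    rw [show p ^ 2 * p ^ 2 = p ^ (2 * (1 + 1)) by ring]
    field_simp
  | (i + 2) => by
    have h1 := seqP_next hb (i + 1)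
    have h2 := seqP_next hb i
    change seqP p (nextLeft p a b) (nextRight p a b) (i + 2) ^ (p ^ 2)
        - nextLeft p a b ^ (p ^ (2 * i + 2)) * seqP p (nextLeft p a b) (nextRight p a b) (i + 1)
      = (seqP p a b (i + 3) ^ (p ^ 2) - a ^ (p ^ (2 * (i + 1) + 2)) * seqP p a b (i + 2))
        / b ^ (p ^ (2 * (i + 3)))
    rw [h1, h2, nextLeft]
    generalize seqP p a b (i + 1 + 2) = y
    generalize seqP p a b (i + 2) = z
    rw [show p ^ (2 * (i + 1 + 1)) = p ^ (2 * i + 2) * p ^ 2 by ring,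
      show p ^ (2 * (i + 1) + 2) = p ^ 2 * p ^ (2 * i + 2) by ring,
      show p ^ (2 * (i + 3)) = p ^ 2 * p ^ 2 * p ^ (2 * i + 2) by ring,
      show p ^ (2 * (i + 1)) = p ^ (2 * i + 2) by ring]
    generalize p ^ (2 * i + 2) = M
    generalize p ^ 2 = N
    have hNM : M * N * N = N * N * M := by ring
    simp only [div_pow, mul_pow, ← pow_mul, hNM]
    field_simp

lemma keyValue_one : keyValue p 1 = 1 / (p : ℝ) ^ 2 := by simp [keyValue]

lemma keyValue_succ (hp : p ≠ 0) (i : ℕ) :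
    keyValue p (i + 1) - p ^ (2 * i) * keyValue p 1 = 1 / (p : ℝ) ^ 2 * keyValue p i := by
  have hp0 : (p : ℝ) ≠ 0 := by exact_mod_cast hp
  rw [keyValue_one, keyValue, keyValue, Finset.sum_range_succ,
    show (p : ℝ) ^ (2 * (i + 1)) = p ^ (2 * i) * p ^ 2 by ring,
    show (p : ℝ) ^ (4 * i) = p ^ (2 * i) * p ^ (2 * i) by ring]
  field_simp
  ring

namespace IsParameterPair

variable (h : IsParameterPair F p ν c a b)
include h

lemma value_right : ν b = ((c / (p : ℝ) ^ 2 : ℝ) : WithTop ℝ) := by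
  have := h.value_seqP 1 le_rfl
  rw [keyValue_one] at this
  rw [show b = seqP p a b 1 from rfl, this]
  congr 1
  ring

lemma right_ne_zero : b ≠ 0 := ne_zero_of_value (h.value_right)

lemma value_left_pos : 0 < ν a := by
  rw [h.value_left]; exact_mod_cast h.pos

lemma value_right_pos (hp : p ≠ 0) : 0 < ν b := by
  have hp0 : (0 : ℝ) < p := by exact_mod_cast Nat.pos_of_ne_zero hp
  have := h.pos
  rw [h.value_right]
  have h2 : 0 < c / (p : ℝ) ^ 2 := by positivity
  exact_mod_cast h2

lemma value_div_pow (j : ℕ) :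
    ν (a / b ^ j) = ((c - j * (c / (p : ℝ) ^ 2) : ℝ) : WithTop ℝ) :=
  value_div h.value_left (value_pow (h.value_right) j)

lemma value_unit (hp : p ≠ 0) : ν (a / b ^ (p ^ 2)) = 0 := by
  have hp0 : (p : ℝ) ≠ 0 := by exact_mod_cast hp
  have h0 : c - (p ^ 2 : ℕ) * (c / (p : ℝ) ^ 2) = 0 := by
    push_cast
    rw [mul_div_cancel₀ _ (pow_ne_zero 2 hp0), sub_self]
  rw [h.value_div_pow, h0]
  rfl

/-- The new pair satisfies the same conditions, with the values scaled by `p⁻²`. -/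
lemma next (hp : p ≠ 0) :
    IsParameterPair F p ν (c / (p : ℝ) ^ 2) (nextLeft p a b) (nextRight p a b) := by
  have hb := h.right_ne_zero
  have ha : a ≠ 0 := ne_zero_of_value h.value_left
  have hp0 : (0 : ℝ) < p := by exact_mod_cast Nat.pos_of_ne_zero hp
  have hc := h.pos
  refine ⟨?_, h.trivial_on_constants, by positivity, ?_, ?_⟩
  · set L := IntermediateField.adjoin F {nextLeft p a b, nextRight p a b} with hL
    have h1 : nextLeft p a b ∈ L := IntermediateField.subset_adjoin F _ (by simp)
    have h2 : nextRight p a b ∈ L := IntermediateField.subset_adjoin F _ (by simp)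
    have h3 : a / b ^ (p ^ 2) ∈ L := by
      have : a / b ^ (p ^ 2) = 1 - nextRight p a b := by rw [nextRight]; ring
      rw [this]
      exact sub_mem (one_mem _) h2
    have h4 : b ∈ L := by
      have : b = nextLeft p a b / (a / b ^ (p ^ 2)) ^ (p ^ 2) := by
        rw [nextLeft]; field_simp
      rw [this]
      exact div_mem h1 (pow_mem h3 _)
    have h5 : a ∈ L := by
      have : a = a / b ^ (p ^ 2) * b ^ (p ^ 2) := by field_simp
      rw [this]
      exact mul_mem h3 (pow_mem h4 _)
    rw [eq_top_iff, ← h.adjoin_eq_top, IntermediateField.adjoin_le_iff]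
    rintro z (rfl | rfl)
    · exact h5
    · exact h4
  · rw [nextLeft, ν.map_mul, ν.map_pow, h.value_unit hp, smul_zero, zero_add, h.value_right]
  · rintro (_ | i) hi
    · omega
    · rw [seqP_next hb, value_div (h.value_seqP (i + 2) (by omega))
        (value_pow (show ν b = _ from h.value_seqP 1 le_rfl) _)]
      congr 1
      have := keyValue_succ hp (i + 1)
      push_cast
      linear_combination c * this

lemma value_next_right_pos (hp : p ≠ 0) : 0 < ν (nextRight p a b) :=
  (h.next hp).value_right_pos hp

/-- The first `p² - 1` quadratic transforms divide `a` by `b`. -/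
lemma iterate_quadraticTransform_of_lt (hp : p ≠ 0) (j : ℕ) (hj : j < p ^ 2) :
    (quadraticTransform ν)^[j] (originLocalRing F a b) = originLocalRing F (a / b ^ j) b := by
  induction j with
  | zero => simp
  | succ j ih =>
    have hp0 : (0 : ℝ) < p := by exact_mod_cast Nat.pos_of_ne_zero hp
    have hc := h.pos
    have hs : 0 < c / (p : ℝ) ^ 2 := by positivity
    have hlt : 0 < c - (j + 1 : ℕ) * (c / (p : ℝ) ^ 2) := by
      have h1 : ((j + 1 : ℕ) : ℝ) < (p : ℝ) ^ 2 := by exact_mod_cast hj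
      have h2 := mul_lt_mul_of_pos_right h1 hs
      rw [mul_div_cancel₀ _ (by positivity)] at h2
      linarith
    have hval := h.value_div_pow (j + 1)
    have hdiv : a / b ^ j / b - algebraMap F K 0 = a / b ^ (j + 1) := by
      rw [map_zero, sub_zero, div_div, pow_succ]
    rw [Function.iterate_succ_apply', ih (by omega),
      quadraticTransform_originLocalRing h.trivial_on_constants hs (h.value_right) ?_ 0 ?_,
      hdiv]
    · rw [h.value_right, h.value_div_pow]
      push_cast at hlt
      refine WithTop.coe_le_coe.2 ?_
      linarith
    · rw [hdiv, hval]
      exact_mod_cast hlt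

/-- After `p²` quadratic transforms the local ring is that of the new pair of parameters. -/
lemma iterate_quadraticTransform (hp : p ≠ 0) :
    (quadraticTransform ν)^[p ^ 2] (originLocalRing F a b)
      = originLocalRing F (nextLeft p a b) (nextRight p a b) := by
  have hp0 : (0 : ℝ) < p := by exact_mod_cast Nat.pos_of_ne_zero hp
  have hc := h.pos
  have hb := h.right_ne_zero
  have hs : 0 < c / (p : ℝ) ^ 2 := by positivity
  have hpp : 0 < p ^ 2 := by positivity
  have hF := h.trivial_on_constants
  have hnext := h.next hp
  obtain ⟨q, hq⟩ : ∃ q, p ^ 2 = q + 1 := ⟨p ^ 2 - 1, by omega⟩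
  have hdiv : a / b ^ q / b - algebraMap F K 1 = - nextRight p a b := by
    rw [map_one, div_div, ← pow_succ, ← hq, nextRight]; ring
  have hpos : 0 < ν (-nextRight p a b) := by
    rw [ν.map_neg]; exact h.value_next_right_pos hp
  have hle : ν b ≤ ν (a / b ^ q) := by
    rw [h.value_right, h.value_div_pow]
    refine WithTop.coe_le_coe.2 (le_of_eq ?_)
    have h1 : (q : ℝ) = (p : ℝ) ^ 2 - 1 := by
      rw [eq_sub_iff_add_eq]; exact_mod_cast hq.symm
    rw [h1]
    field_simp
    ring
  rw [hq, Function.iterate_succ_apply', h.iterate_quadraticTransform_of_lt hp q (by omega),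
    quadraticTransform_originLocalRing hF hs (h.value_right) hle 1 (hdiv ▸ hpos), hdiv]
  have hunit : a / b ^ (p ^ 2) = 1 - nextRight p a b := by rw [nextRight]; ring
  refine originLocalRing_eq hF hpos (h.value_right_pos hp) hnext.value_left_pos
    (h.value_next_right_pos hp) (Subring.neg_mem _ right_mem_originLocalRing) ?_ ?_ ?_
  · have hmem : ((a / b ^ (p ^ 2)) ^ (p ^ 2))⁻¹
        ∈ originLocalRing F (nextLeft p a b) (nextRight p a b) := by
      refine inv_mem_originLocalRing hF hnext.value_left_pos (h.value_next_right_pos hp) ?_ ?_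
      · rw [hunit]
        exact Subring.pow_mem _
          (Subring.sub_mem _ (Subring.one_mem _) right_mem_originLocalRing) _
      · rw [ν.map_pow, h.value_unit hp, smul_zero]
    have ha : a ≠ 0 := ne_zero_of_value h.value_left
    have : b = ((a / b ^ (p ^ 2)) ^ (p ^ 2))⁻¹ * nextLeft p a b := by
      rw [nextLeft]; field_simp
    have hmul := Subring.mul_mem _ hmem left_mem_originLocalRing
    rwa [← this] at hmul
  · have : nextLeft p a b = (1 + -nextRight p a b) ^ (p ^ 2) * b := by
      rw [nextLeft, hunit, sub_eq_add_neg]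
    rw [this]
    exact Subring.mul_mem _ (Subring.pow_mem _
      (Subring.add_mem _ (Subring.one_mem _) left_mem_originLocalRing) _)
      right_mem_originLocalRing
  · simpa using Subring.neg_mem _
      (left_mem_originLocalRing (F := F) (a := -nextRight p a b) (b := b))

lemma adjoin_div_pow_eq_top (j : ℕ) :
    IntermediateField.adjoin F {a / b ^ j, b} = ⊤ := by
  set L := IntermediateField.adjoin F {a / b ^ j, b} with hL
  have h1 : a / b ^ j ∈ L := IntermediateField.subset_adjoin F _ (by simp)
  have h2 : b ∈ L := IntermediateField.subset_adjoin F _ (by simp)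
  have hb := h.right_ne_zero
  have h3 : a ∈ L := by
    have : a = a / b ^ j * b ^ j := by field_simp
    rw [this]
    exact mul_mem h1 (pow_mem h2 _)
  rw [eq_top_iff, ← h.adjoin_eq_top, IntermediateField.adjoin_le_iff]
  rintro z (rfl | rfl)
  · exact h3
  · exact h2

end IsParameterPair

lemma seqP_mem {A : Subring K} (ha : a ∈ A) (hb : b ∈ A) : ∀ i, seqP p a b i ∈ A
  | 0 => ha
  | 1 => hb
  | 2 => Subring.sub_mem _ (Subring.pow_mem _ hb _) ha
  | (i + 3) => Subring.sub_mem _ (Subring.pow_mem _ (seqP_mem ha hb (i + 2)) _)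
      (Subring.mul_mem _ (Subring.pow_mem _ ha _) (seqP_mem ha hb (i + 1)))

/-- The parameters of the `k`-th local ring `R_k`. The second one is `P_{k,1}`; the first one is
associated to `P_{k,0}` but not equal to it for `k ≥ 1`. -/
def params (p : ℕ) (u v : K) : ℕ → K × K
  | 0 => (u, v)
  | (k + 1) => (nextLeft p (params p u v k).1 (params p u v k).2,
      nextRight p (params p u v k).1 (params p u v k).2)

section Sequence

variable {u v : K} (hp : p ≠ 0) (h : IsParameterPair F p ν 1 u v)
include hp h

lemma isParameterPair_params (k : ℕ) :
    IsParameterPair F p ν (1 / (p : ℝ) ^ (2 * k)) (params p u v k).1 (params p u v k).2 := by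
  induction k with
  | zero => simpa [params] using h
  | succ k ih =>
    have := ih.next hp
    rwa [div_div, ← pow_add] at this

lemma seqPP_eq (k i : ℕ) : seqPP p u v k (i + 1)
    = seqP p (params p u v k).1 (params p u v k).2 (i + 1) := by
  induction k generalizing i with
  | zero => rfl
  | succ k ih =>
    rw [seqPP, ih, ih, params, seqP_next ((isParameterPair_params hp h k).right_ne_zero)]
    rfl

lemma iteratedTransform_mul (k : ℕ) : iteratedTransform F u v ν (k * p ^ 2)
    = originLocalRing F (params p u v k).1 (params p u v k).2 := by
  induction k with
  | zero => simp [iteratedTransform, params]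
  | succ k ih =>
    rw [iteratedTransform, Nat.succ_mul, add_comm, Function.iterate_add_apply]
    rw [iteratedTransform] at ih
    rw [ih, (isParameterPair_params hp h k).iterate_quadraticTransform hp]
    rfl

lemma iteratedTransform_mul_add (k j : ℕ) (hj : j < p ^ 2) :
    iteratedTransform F u v ν (k * p ^ 2 + j)
      = originLocalRing F ((params p u v k).1 / (params p u v k).2 ^ j) (params p u v k).2 := by
  have h1 := iteratedTransform_mul hp h k
  rw [iteratedTransform] at h1 ⊢
  rw [add_comm, Function.iterate_add_apply, h1,
    (isParameterPair_params hp h k).iterate_quadraticTransform_of_lt hp j hj]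

lemma originLocalRing_params_le_succ (k : ℕ) :
    originLocalRing F (params p u v k).1 (params p u v k).2
      ≤ originLocalRing F (params p u v (k + 1)).1 (params p u v (k + 1)).2 := by
  have hle : ∀ (n : ℕ) (A : Subring K), A ≤ (quadraticTransform ν)^[n] A := by
    intro n A
    induction n with
    | zero => exact le_rfl
    | succ n ih =>
      rw [Function.iterate_succ_apply']
      exact ih.trans (le_quadraticTransform ν _)
  have h1 := (isParameterPair_params hp h k).iterate_quadraticTransform hp
  exact (hle (p ^ 2) _).trans h1.le

/-- In `R_k` the element `u` is a unit times a positive power of the first parameter. -/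
lemma exists_eq_unit_mul_pow (k : ℕ) :
    ∃ w ∈ originLocalRing F (params p u v k).1 (params p u v k).2, ν w = 0 ∧
      ∃ n, 0 < n ∧ u = w * (params p u v k).1 ^ n := by
  induction k with
  | zero => exact ⟨1, Subring.one_mem _, ν.map_one, 1, one_pos, by simp [params]⟩
  | succ k ih =>
    obtain ⟨w, hw, hw0, n, hn, hu⟩ := ih
    have hk := isParameterPair_params hp h k
    have hk' := isParameterPair_params hp h (k + 1)
    have hle := originLocalRing_params_le_succ hp h k
    set a := (params p u v k).1 with ha
    set b := (params p u v k).2 with hb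
    set a' := (params p u v (k + 1)).1 with ha'
    set b' := (params p u v (k + 1)).2 with hb'
    have hb0 := hk.right_ne_zero
    have ha0 : a ≠ 0 := ne_zero_of_value hk.value_left
    have hv := hk.value_unit hp
    have hmem : a / b ^ (p ^ 2) ∈ originLocalRing F a' b' := by
      have h1 : a / b ^ (p ^ 2) = 1 - b' := by
        change _ = 1 - (1 - a / b ^ (p ^ 2))
        ring
      rw [h1]
      exact Subring.sub_mem _ (Subring.one_mem _) right_mem_originLocalRing
    have hinv := inv_mem_originLocalRing hk'.trivial_on_constants hk'.value_left_pos
      (hk'.value_right_pos hp) hmem hv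
    have ha_eq : a = a / b ^ (p ^ 2) * (a / b ^ (p ^ 2))⁻¹ ^ (p ^ 4) * a' ^ (p ^ 2) := by
      change a = _ * _ * ((a / b ^ (p ^ 2)) ^ (p ^ 2) * b) ^ (p ^ 2)
      have hq : a / b ^ (p ^ 2) ≠ 0 := div_ne_zero ha0 (pow_ne_zero _ hb0)
      have hq' : a / b ^ (p ^ 2) * b ^ (p ^ 2) = a := by field_simp
      rw [mul_pow, ← pow_mul, show p ^ 2 * p ^ 2 = p ^ 4 by ring]
      generalize a / b ^ (p ^ 2) = q at hq hq'
      rw [mul_assoc, ← mul_assoc (q⁻¹ ^ p ^ 4), ← mul_pow, inv_mul_cancel₀ hq, one_pow, one_mul,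
        hq']
    refine ⟨w * (a / b ^ (p ^ 2) * (a / b ^ (p ^ 2))⁻¹ ^ (p ^ 4)) ^ n,
      Subring.mul_mem _ (hle hw) (Subring.pow_mem _
        (Subring.mul_mem _ hmem (Subring.pow_mem _ hinv _)) _), ?_, p ^ 2 * n, by positivity, ?_⟩
    · rw [ν.map_mul, ν.map_pow, ν.map_mul, ν.map_pow, value_inv_eq_zero hv, hv, hw0]
      simp
    · rw [pow_mul, mul_assoc, ← mul_pow, ← ha_eq]
      exact hu

/-- The divisor of `u` has a single component exactly in every `p²`-th of the rings. -/
lemma hasSingleComponent_iff (huv : AlgebraicIndependent F ![u, v]) (n : ℕ) :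
    HasSingleComponent u (iteratedTransform F u v ν n) ↔ p ^ 2 ∣ n := by
  have hpp : 0 < p ^ 2 := by positivity
  have hn : n = n / p ^ 2 * p ^ 2 + n % p ^ 2 := (Nat.div_add_mod' n (p ^ 2)).symm
  have hlt := Nat.mod_lt n hpp
  have hk := isParameterPair_params hp h (n / p ^ 2)
  have hF := hk.trivial_on_constants
  obtain ⟨w, hw, hw0, m, hm, hu⟩ := exists_eq_unit_mul_pow hp h (n / p ^ 2)
  have hb0 := hk.right_ne_zero
  have hring := iteratedTransform_mul_add hp h (n / p ^ 2) (n % p ^ 2) hlt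
  rw [← hn] at hring
  rw [Nat.dvd_iff_mod_eq_zero, hring]
  set a := (params p u v (n / p ^ 2)).1 with ha
  set b := (params p u v (n / p ^ 2)).2 with hb
  constructor
  · intro hsingle
    by_contra hj
    obtain ⟨j, hj'⟩ := Nat.exists_eq_succ_of_ne_zero hj
    obtain ⟨m', rfl⟩ := Nat.exists_eq_succ_of_ne_zero hm.ne'
    rw [hj'] at hsingle hlt
    have hind := algebraicIndependent_of_adjoin_eq_top huv (hk.adjoin_div_pow_eq_top (j + 1))
    have haA : a / b ^ (j + 1) ∈ originLocalRing F (a / b ^ (j + 1)) b :=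
      left_mem_originLocalRing
    have hbA : b ∈ originLocalRing F (a / b ^ (j + 1)) b := right_mem_originLocalRing
    have ha_eq : a = a / b ^ (j + 1) * b ^ (j + 1) := by field_simp
    have haA' : a ∈ originLocalRing F (a / b ^ (j + 1)) b := by
      have := Subring.mul_mem _ haA (Subring.pow_mem _ hbA (j + 1))
      rwa [← ha_eq] at this
    have hpos : 0 < ν (a / b ^ (j + 1)) := by
      rw [hk.value_div_pow]
      have h1 : ((j + 1 : ℕ) : ℝ) < (p : ℝ) ^ 2 := by exact_mod_cast hlt
      have hp0 : (0 : ℝ) < p := by exact_mod_cast Nat.pos_of_ne_zero hp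
      have hs : 0 < 1 / (p : ℝ) ^ (2 * (n / p ^ 2)) / (p : ℝ) ^ 2 := by positivity
      have h2 := mul_lt_mul_of_pos_right h1 hs
      rw [mul_div_cancel₀ _ (by positivity)] at h2
      have h3 := sub_pos.2 h2
      exact_mod_cast h3
    have hwA : w ∈ originLocalRing F (a / b ^ (j + 1)) b :=
      originLocalRing_le hF hk.value_left_pos (hk.value_right_pos hp)
        algebraMap_mem_originLocalRing haA' hbA
        (fun z hz h0 => inv_mem_originLocalRing hF hpos (hk.value_right_pos hp) hz h0) hw
    refine not_hasSingleComponent_of_eq hind (z := w * a ^ m' * b ^ (j + 1))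
      (w := w * a ^ m' * (a / b ^ (j + 1)) * b ^ j) ?_ ?_ ?_ ?_ hsingle
    · exact Subring.mul_mem _ (Subring.mul_mem _ hwA (Subring.pow_mem _ haA' _))
        (Subring.pow_mem _ hbA _)
    · exact Subring.mul_mem _ (Subring.mul_mem _ (Subring.mul_mem _ hwA
        (Subring.pow_mem _ haA' _)) haA) (Subring.pow_mem _ hbA _)
    · rw [hu, Nat.succ_eq_add_one]
      field_simp
      ring
    · rw [hu, Nat.succ_eq_add_one]
      field_simp
      ring
  · intro hj
    rw [hj, pow_zero, div_one]
    have hind := algebraicIndependent_of_adjoin_eq_top huv hk.adjoin_eq_top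
    have hw' := inv_mem_originLocalRing hF hk.value_left_pos (hk.value_right_pos hp) hw hw0
    exact hasSingleComponent_of_eq hind hm hu hw hw'
      (ne_zero_of_value (r := 0) (by simpa using hw0))

lemma freeTransform_eq (huv : AlgebraicIndependent F ![u, v]) (k : ℕ) :
    freeTransform F u v ν k
      = originLocalRing F (params p u v k).1 (params p u v k).2 := by
  have hpp : 0 < p ^ 2 := by positivity
  have hmono : StrictMono fun i : ℕ => i * p ^ 2 := fun i j hij =>
    Nat.mul_lt_mul_of_pos_right hij hpp
  have hinf : ¬ (Set.ofPred fun n => p ^ 2 ∣ n).Finite := fun hfin => by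
    refine Set.infinite_of_injective_forall_mem hmono.injective (fun i => ?_) hfin
    exact Dvd.intro_left i rfl
  have hnth : Nat.nth (fun n => p ^ 2 ∣ n) k = k * p ^ 2 := by
    have h1 := Nat.nth_comp_of_strictMono (p := fun n => p ^ 2 ∣ n) (n := k) hmono
      (fun n hn => ⟨n / p ^ 2, Nat.div_mul_cancel hn⟩) (fun hfin => absurd hfin hinf)
    rw [← h1]
    simp
  rw [freeTransform]
  simp only [hasSingleComponent_iff hp h huv]
  rw [hnth, iteratedTransform_mul hp h]

end Sequence

end Parameters

/-! ### The partial sums of the geometric series -/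

section GeometricSeries

variable {p : ℕ}

lemma scaled_keyValue (hp : p ≠ 0) (k : ℕ) : 1 / (p : ℝ) ^ (2 * k) * keyValue p (k + 2)
    = ∑ i ∈ Finset.range (k + 2), 1 / (p : ℝ) ^ (4 * i) := by
  have hp0 : (p : ℝ) ≠ 0 := by exact_mod_cast hp
  rw [← Finset.sum_range_reflect, keyValue, Finset.sum_div, Finset.mul_sum]
  refine Finset.sum_congr rfl fun j hj => ?_
  obtain ⟨d, hd⟩ : ∃ d, k + 1 = j + d := ⟨k + 1 - j, by have := Finset.mem_range.1 hj; omega⟩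
  rw [show k + 2 - 1 - j = d by omega, div_mul_div_comm, ← pow_add,
    show 2 * k + 2 * (k + 2) = 4 * j + 4 * d by omega, pow_add]
  field_simp

lemma sum_lt_limit (hp : 1 < p) (n : ℕ) :
    ∑ i ∈ Finset.range n, 1 / (p : ℝ) ^ (4 * i) < (p : ℝ) ^ 4 / ((p : ℝ) ^ 4 - 1) := by
  have hp1 : (1 : ℝ) < p := by exact_mod_cast hp
  have hp4 : (1 : ℝ) < (p : ℝ) ^ 4 := one_lt_pow₀ hp1 (by norm_num)
  have hsub : (0 : ℝ) < (p : ℝ) ^ 4 - 1 := by linarith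
  have key : ∑ i ∈ Finset.range n, 1 / (p : ℝ) ^ (4 * i)
      + 1 / (p : ℝ) ^ (4 * n) * ((p : ℝ) ^ 4 / ((p : ℝ) ^ 4 - 1))
      = (p : ℝ) ^ 4 / ((p : ℝ) ^ 4 - 1) := by
    induction n with
    | zero => simp
    | succ n ih =>
      have hstep : 1 / (p : ℝ) ^ (4 * n)
          + 1 / (p : ℝ) ^ (4 * (n + 1)) * ((p : ℝ) ^ 4 / ((p : ℝ) ^ 4 - 1))
          = 1 / (p : ℝ) ^ (4 * n) * ((p : ℝ) ^ 4 / ((p : ℝ) ^ 4 - 1)) := by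
        rw [show 4 * (n + 1) = 4 * n + 4 by ring, pow_add]
        field_simp
        ring
      rw [Finset.sum_range_succ]
      linarith
  have : 0 < 1 / (p : ℝ) ^ (4 * n) * ((p : ℝ) ^ 4 / ((p : ℝ) ^ 4 - 1)) := by positivity
  linarith

lemma limit_lt (hp : 1 < p) : (p : ℝ) ^ 4 / ((p : ℝ) ^ 4 - 1) < 3 / 2 := by
  have hp1 : (2 : ℝ) ≤ p := by exact_mod_cast hp
  have hp4 : (2 : ℝ) ^ 4 ≤ (p : ℝ) ^ 4 := pow_le_pow_left₀ (by norm_num) hp1 4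
  rw [div_lt_div_iff₀ (by linarith) (by norm_num)]
  linarith

/-- `γ_k / p` does not lie in the group `p^{-4(k+1)} ℤ`, for `γ_k = 1 + p⁻⁴ + ⋯ + p^{-4(k+1)}`. -/
lemma sum_ne_mul (hp : 1 < p) (k : ℕ) (z : ℤ) :
    ∑ i ∈ Finset.range (k + 2), 1 / (p : ℝ) ^ (4 * i)
      ≠ p * (1 / (p : ℝ) ^ (2 * k) * z / (p : ℝ) ^ (2 * (k + 2))) := by
  intro h
  have hp0 : (p : ℝ) ≠ 0 := by positivity
  rw [← scaled_keyValue (by omega), keyValue] at h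
  have h1 : ∑ j ∈ Finset.range (k + 2), (p : ℝ) ^ (4 * j) = p * z := by
    field_simp at h
    exact h
  have h2 : ∑ j ∈ Finset.range (k + 2), (p : ℤ) ^ (4 * j) = p * z := by exact_mod_cast h1
  rw [Finset.sum_range_succ'] at h2
  have h3 : (p : ℤ) ∣ ∑ j ∈ Finset.range (k + 1), (p : ℤ) ^ (4 * (j + 1)) :=
    Finset.dvd_sum fun j _ => dvd_pow_self _ (by omega)
  have h4 : (p : ℤ) ∣ 1 := by
    have := (dvd_add_right h3).1 (Dvd.intro _ h2.symm)
    simpa using this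
  have h5 : p ∣ 1 := by exact_mod_cast h4
  have := Nat.le_of_dvd one_pos h5
  omega

end GeometricSeries

/-! ### Approximation of `x` by `p`-th roots in the local rings -/

section Approximation

variable {F K : Type*} [Field F] [Field K] [Algebra F K] {p : ℕ}
  {ν : AddValuation K (WithTop ℝ)}

/-- In characteristic `p`, a term of the sequence of one pair in terms of the sequence of the next
pair: this is the recursion of the new pair, in which the coefficient of the old term is the unit
`(1 - b') ^ (p ^ (2 * (i + 2)))`, with `b' = nextRight p a b`. -/
lemma seqP_eq_next [Fact p.Prime] [CharP K p] {a b : K} (hb : b ≠ 0) (i : ℕ) :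
    seqP p a b (i + 2) = seqP p (nextLeft p a b) (nextRight p a b) (i + 2) ^ (p ^ 2)
      - seqP p (nextLeft p a b) (nextRight p a b) (i + 3)
      + nextRight p a b ^ (p ^ (2 * (i + 2))) * seqP p a b (i + 2) := by
  have h1 : nextLeft p a b ^ (p ^ (2 * i + 2))
      * seqP p (nextLeft p a b) (nextRight p a b) (i + 1)
      = (1 - nextRight p a b ^ (p ^ (2 * (i + 2)))) * seqP p a b (i + 2) := by
    have hunit : a / b ^ (p ^ 2) = 1 - nextRight p a b := by rw [nextRight]; ring
    have hbpow : b ^ (p ^ (2 * i + 2)) ≠ 0 := pow_ne_zero _ hb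
    have hpow : (1 - nextRight p a b) ^ (p ^ (2 * (i + 2)))
        = 1 - nextRight p a b ^ (p ^ (2 * (i + 2))) := by
      rw [sub_pow_char_pow, one_pow]
    rw [seqP_next hb, nextLeft, hunit, mul_pow, ← pow_mul, ← pow_add,
      show 2 + (2 * i + 2) = 2 * (i + 2) by ring, hpow, show 2 * (i + 1) = 2 * i + 2 by ring]
    field_simp
  rw [seqP, h1]
  ring

variable {K₁ : Type*} [Field K₁] [Algebra K K₁] {ν₁ : AddValuation K₁ (WithTop ℝ)} {u v : K}
  {x : K₁}

lemma artinSchreier_relation (hu : u ≠ 0) (hx : algebraMap K K₁ u = x ^ p / (1 - x ^ (p - 1))) :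
    x ^ p = algebraMap K K₁ u - algebraMap K K₁ u * x ^ (p - 1) := by
  have h0 : 1 - x ^ (p - 1) ≠ 0 := by
    intro h
    rw [h, div_zero] at hx
    exact hu ((map_eq_zero _).1 hx)
  rw [eq_div_iff h0] at hx
  linear_combination -hx

/-- Since `x ^ p = u (1 - x ^ (p - 1))` and `ν u = 1`, the value of `x` is `1 / p`. -/
lemma value_x [Fact p.Prime] (hν₁ : ∀ a : K, ν₁ (algebraMap K K₁ a) = ν a) (hu : ν u = 1)
    (hx : algebraMap K K₁ u = x ^ p / (1 - x ^ (p - 1))) :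
    ν₁ x = ((1 / (p : ℝ) : ℝ) : WithTop ℝ) := by
  have hp := (Fact.out : p.Prime).one_lt
  have hp0 : (0 : ℝ) < p := by exact_mod_cast (by omega : 0 < p)
  have hu' : ν u = ((1 : ℝ) : WithTop ℝ) := by simpa using hu
  have hrel := artinSchreier_relation (ne_zero_of_value hu') hx
  have hx0 : x ≠ 0 := by
    rintro rfl
    rw [zero_pow (by omega), zero_pow (by omega), mul_zero, sub_zero] at hrel
    exact ne_zero_of_value hu' ((map_eq_zero _).1 hrel.symm)
  obtain ⟨r, hr⟩ := (eq_zero_or_value_eq_coe ν₁ x).resolve_left hx0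
  have hv := value_pow hr p
  have hv1 := value_pow hr (p - 1)
  have hprod := value_mul ((hν₁ u).trans hu') hv1
  have hcast : ((p - 1 : ℕ) : ℝ) = p - 1 := by rw [Nat.cast_sub hp.le]; simp
  have hpm : (0 : ℝ) < (p - 1 : ℕ) := by exact_mod_cast (by omega : 0 < p - 1)
  rw [hcast] at hprod hpm
  have hrpos : 0 < r := by
    by_contra hr0
    have hmin := ν₁.map_sub (algebraMap K K₁ u) (algebraMap K K₁ u * x ^ (p - 1))
    rw [← hrel, hν₁, hu', hprod, hv, ← WithTop.coe_min, WithTop.coe_le_coe] at hmin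
    rcases min_le_iff.1 hmin with h | h <;> nlinarith
  have hval : ν₁ (x ^ p) = ((1 : ℝ) : WithTop ℝ) := by
    rw [hrel, ν₁.map_sub_eq_of_lt_left, hν₁, hu']
    rw [hν₁, hu', hprod, WithTop.coe_lt_coe]
    nlinarith
  rw [hval] at hv
  have := WithTop.coe_injective hv
  rw [hr]
  congr 1
  field_simp
  linarith

/-- In every `R_k` there is an approximate `p`-th root of `x ^ p`. It is corrected at each step by
the `p`-th power of `P_{k+1,k+2}`, which replaces `P_{k,k+2}` by `-P_{k+1,k+3}` up to a term of
value at least `2`. -/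
lemma exists_approximation [Fact p.Prime] [CharP F p]
    (h : IsParameterPair F p ν 1 u v) (hν₁ : ∀ a : K, ν₁ (algebraMap K K₁ a) = ν a)
    (hx : algebraMap K K₁ u = x ^ p / (1 - x ^ (p - 1))) (k : ℕ) :
    ∃ y ∈ originLocalRing F (params p u v k).1 (params p u v k).2, ∃ Θ : K₁,
      algebraMap K K₁ y ^ p - x ^ p
        = (-1) ^ k * algebraMap K K₁ (seqP p (params p u v k).1 (params p u v k).2 (k + 2)) + Θ ∧
      (((p : ℝ) ^ 4 / ((p : ℝ) ^ 4 - 1) : ℝ) : WithTop ℝ) < ν₁ Θ := by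
  have hp1 := (Fact.out : p.Prime).one_lt
  have hp : p ≠ 0 := by omega
  have hpR : (2 : ℝ) ≤ p := by exact_mod_cast hp1
  have hlim := limit_lt hp1
  have : CharP K p := charP_of_injective_algebraMap (algebraMap F K).injective p
  have : CharP K₁ p := charP_of_injective_algebraMap (algebraMap K K₁).injective p
  have hu' : ν u = ((1 : ℝ) : WithTop ℝ) := h.value_left
  induction k with
  | zero =>
    refine ⟨v ^ p, Subring.pow_mem _ right_mem_originLocalRing _,
      algebraMap K K₁ u * x ^ (p - 1), ?_, ?_⟩
    · have hrel := artinSchreier_relation (ne_zero_of_value hu') hx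
      simp only [params, seqP, map_sub, map_pow]
      rw [hrel, ← pow_mul, ← sq]
      ring
    · rw [value_mul ((hν₁ u).trans hu') (value_pow (value_x hν₁ (by simpa using hu') hx) (p - 1)),
        WithTop.coe_lt_coe, Nat.cast_sub hp1.le, Nat.cast_one]
      refine hlim.trans_le ?_
      have h1 : 1 / (p : ℝ) ≤ 1 / 2 := one_div_le_one_div_of_le (by norm_num) hpR
      have h2 : ((p : ℝ) - 1) * (1 / p) = 1 - 1 / p := by field_simp
      linarith
  | succ k ih =>
    obtain ⟨y, hy, Θ, hΘ, hΘv⟩ := ih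
    have hk := isParameterPair_params hp h k
    have hle := originLocalRing_params_le_succ hp h k
    have hnext := hk.value_next_right_pos hp
    have hid := seqP_eq_next (p := p) (a := (params p u v k).1) (hk.right_ne_zero) k
    have hval := (isParameterPair_params hp h (k + 1)).value_right
    rw [params] at hle hval ⊢
    set a := (params p u v k).1
    set b := (params p u v k).2
    set z := seqP p (nextLeft p a b) (nextRight p a b) (k + 2)
    refine ⟨y - (-1) ^ k * z ^ p, Subring.sub_mem _ (hle hy) (Subring.mul_mem _
      (Subring.pow_mem _ (Subring.neg_mem _ (Subring.one_mem _)) _) (Subring.pow_mem _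
        (seqP_mem left_mem_originLocalRing right_mem_originLocalRing _) _)),
      (-1) ^ k * algebraMap K K₁ (nextRight p a b ^ (p ^ (2 * (k + 2))) * seqP p a b (k + 2)) + Θ,
      ?_, ?_⟩
    · have hsign : ((-1 : K) ^ k) ^ p = (-1) ^ k := by
        rw [← pow_mul, mul_comm, pow_mul, neg_one_pow_char]
      have hzz : (z ^ p) ^ p = z ^ (p ^ 2) := by rw [← pow_mul, sq]
      rw [← map_pow, sub_pow_char, mul_pow, hsign, hzz, map_sub, map_mul]
      have hid' := congrArg (algebraMap K K₁) hid
      rw [map_add, map_sub, map_pow _ z] at hid'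
      rw [map_pow (algebraMap K K₁) (-1) k, map_neg, map_one, map_pow (algebraMap K K₁) y p]
      rw [map_pow (algebraMap K K₁) z, pow_succ]
      linear_combination hΘ + (-1) ^ k * hid'
    · refine ν₁.map_lt_add ?_ hΘv
      rw [ν₁.map_mul, ν₁.map_pow, ν₁.map_neg, ν₁.map_one, smul_zero, zero_add, hν₁,
        value_mul (value_pow hval _) (hk.value_seqP (k + 2) (by omega)), WithTop.coe_lt_coe,
        scaled_keyValue hp]
      have h1 : ((p ^ (2 * (k + 2)) : ℕ) : ℝ) * (1 / (p : ℝ) ^ (2 * (k + 1)) / (p : ℝ) ^ 2) = 1 := by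
        rw [div_div, ← pow_add, show 2 * (k + 1) + 2 = 2 * (k + 2) by ring]
        push_cast
        field_simp
      have h2 : 1 ≤ ∑ i ∈ Finset.range (k + 2), 1 / (p : ℝ) ^ (4 * i) := by
        rw [Finset.sum_range_succ']
        have : 0 ≤ ∑ i ∈ Finset.range (k + 1), 1 / (p : ℝ) ^ (4 * (i + 1)) :=
          Finset.sum_nonneg fun i _ => by positivity
        simpa using this
      rw [h1]
      linarith

/-- No element of `R_k` has value `γ_k / p`, where `γ_k = 1 + p⁻⁴ + ⋯ + p^{-4(k+1)}`. -/
lemma mul_value_ne_sum [Fact p.Prime] (h : IsParameterPair F p ν 1 u v) (k : ℕ) {f : K}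
    (hf : f ∈ originLocalRing F (params p u v k).1 (params p u v k).2) :
    ν (f ^ p) ≠ ((∑ i ∈ Finset.range (k + 2), 1 / (p : ℝ) ^ (4 * i) : ℝ) : WithTop ℝ) := by
  intro hfp
  have hp1 := (Fact.out : p.Prime).one_lt
  have hp : p ≠ 0 := by omega
  have hpR : (2 : ℝ) ≤ p := by exact_mod_cast hp1
  have hk := isParameterPair_params hp h k
  have hf0 : f ≠ 0 := by
    rintro rfl
    exact ne_zero_of_value hfp (zero_pow hp)
  obtain ⟨r, hr⟩ := (eq_zero_or_value_eq_coe ν f).resolve_left hf0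
  have hpr := value_pow hr p
  rw [hfp] at hpr
  have hsum := WithTop.coe_injective hpr
  have hrlt : r < 1 := by
    have h1 := (sum_lt_limit hp1 (k + 2)).trans (limit_lt hp1)
    rw [hsum] at h1
    nlinarith
  -- The value of `P_{k,k+3}` is at least `p²`, the last term of its defining sum.
  have hbound : 1 ≤ 1 / (p : ℝ) ^ (2 * k) * keyValue p (k + 2 + 1) := by
    rw [keyValue, Finset.sum_range_succ, div_mul_div_comm, one_mul, ← pow_add,
      le_div_iff₀ (by positivity), one_mul]
    have h1 : 0 ≤ ∑ j ∈ Finset.range (k + 2), (p : ℝ) ^ (4 * j) :=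
      Finset.sum_nonneg fun j _ => by positivity
    have h2 : (p : ℝ) ^ (2 * k + 2 * (k + 2 + 1)) ≤ (p : ℝ) ^ (4 * (k + 2)) :=
      pow_le_pow_right₀ (by linarith) (by omega)
    linarith
  obtain ⟨z, hz⟩ := value_of_lt_keyValue hp1 hk.trivial_on_constants hk.pos hk.value_left
    (hk.value_right_pos hp) hk.value_seqP (k + 2) hf
    (by rw [hr, WithTop.coe_lt_coe]; exact hrlt.trans_le hbound)
  rw [hr] at hz
  rw [WithTop.coe_injective hz] at hsum
  exact sum_ne_mul hp1 k z hsum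

end Approximation

end ArtinSchreier
end

open ArtinSchreier in
theorem theorem4p4
    {F K K₁ : Type*} [Field F] [Field K] [Field K₁] [Algebra F K] [Algebra K K₁]
    (p : ℕ) [Fact p.Prime] [CharP F p] [IsAlgClosed F]
    (u v : K) (huv : AlgebraicIndependent F ![u, v])
    (hK : IntermediateField.adjoin F {u, v} = ⊤)
    (x : K₁) (hx : algebraMap K K₁ u = x ^ p / (1 - x ^ (p - 1)))
    (hK₁ : IntermediateField.adjoin K {x} = ⊤)
    (ν : AddValuation K (WithTop ℝ)) (hν : ArtinSchreier.IsDeterminedByP F p u v ν)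
    (ν₁ : AddValuation K₁ (WithTop ℝ)) (hν₁ : ∀ a : K, ν₁ (algebraMap K K₁ a) = ν a)
    (k : ℕ) :
    (∃ h ∈ ArtinSchreier.freeTransform F u v ν k, ∃ Θ : K₁,
      algebraMap K K₁ h ^ p - x ^ p
          = (-1) ^ k * algebraMap K K₁ (ArtinSchreier.seqPP p u v k (k + 2)) + Θ ∧
      (((p : ℝ) ^ 4 / ((p : ℝ) ^ 4 - 1) : ℝ) : WithTop ℝ) < ν₁ Θ ∧
      ν₁ (algebraMap K K₁ h ^ p - x ^ p)
          = ((∑ i ∈ Finset.range (k + 2), 1 / (p : ℝ) ^ (4 * i) : ℝ) : WithTop ℝ)) ∧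
    ∀ g ∈ ArtinSchreier.freeTransform F u v ν k,
      ν₁ (algebraMap K K₁ g ^ p - x ^ p)
          ≤ ((∑ i ∈ Finset.range (k + 2), 1 / (p : ℝ) ^ (4 * i) : ℝ) : WithTop ℝ) := by
  have hp1 := (Fact.out : p.Prime).one_lt
  have hp : p ≠ 0 := by omega
  have : CharP K p := charP_of_injective_algebraMap (algebraMap F K).injective p
  have hpair : IsParameterPair F p ν 1 u v := by
    refine ⟨hK, hν.trivial_on_constants, one_pos, by simpa using hν.value_u, fun i hi => ?_⟩
    rw [hν.value_P i hi, sum_zpow_eq_keyValue hp, one_mul]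
  have hk := isParameterPair_params hp hpair k
  rw [freeTransform_eq hp hpair huv k, seqPP_eq hp hpair k (k + 1)]
  obtain ⟨y, hy, Θ, hΘ, hΘv⟩ := exists_approximation hpair hν₁ hx k
  have hval : ν₁ (algebraMap K K₁ y ^ p - x ^ p)
      = ((∑ i ∈ Finset.range (k + 2), 1 / (p : ℝ) ^ (4 * i) : ℝ) : WithTop ℝ) := by
    have h1 : ν₁ ((-1) ^ k * algebraMap K K₁
        (seqP p (params p u v k).1 (params p u v k).2 (k + 2)))
        = ((∑ i ∈ Finset.range (k + 2), 1 / (p : ℝ) ^ (4 * i) : ℝ) : WithTop ℝ) := by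
      rw [ν₁.map_mul, ν₁.map_pow, ν₁.map_neg, ν₁.map_one, smul_zero, zero_add, hν₁,
        hk.value_seqP (k + 2) (by omega), scaled_keyValue hp]
    rw [hΘ, ν₁.map_add_eq_of_lt_left, h1]
    rw [h1]
    exact (WithTop.coe_lt_coe.2 (sum_lt_limit hp1 (k + 2))).trans hΘv
  refine ⟨⟨y, hy, Θ, hΘ, hΘv, hval⟩, fun g hg => ?_⟩
  by_contra hlt
  rw [not_le] at hlt
  -- Otherwise `(y - g) ^ p` would have the same value as `y ^ p - x ^ p`.
  refine mul_value_ne_sum hpair k (Subring.sub_mem _ hy hg) ?_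
  rw [← hν₁, sub_pow_char, map_sub, map_pow, map_pow, ← sub_sub_sub_cancel_right _ _ (x ^ p),
    ν₁.map_sub_eq_of_lt_left (hval.symm ▸ hlt), hval]
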